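/- Let $\mathcal Y$ be a measurable space and $P>0$. A channel with memory, with real inputs and outputs in $\mathcal Y$, is given by its transition probability laws $W_n(\mathrm d y\mid x)$, $x\in\mathbb R^n$, $y\in\mathcal Y^n$, $n\ge 0$. Assume that there is a stationary and ergodic process $(\mathsf x_k,\mathsf y_k)_{k\ge 0}$ such that for every $n$ its initial segment of length $n$ has the law of an input block distributed as $\mathcal N(0,P I_n)$ together with the corresponding output block of $W_n$. For a super symbol length $S$ let $\underline{\mathsf x}\sim\mathcal N(0,PI_S)$ and let $\underline{\mathsf y}$ be the corresponding output super symbol, let $g_S(\underline y)=\mathbf E[\underline{\mathsf x}\mid\underline{\mathsf y}=\underline y]$ be (any measurable version of) the MMSE smoother, let $a_S=\mathbf E[\underline{\mathsf x}^{T}g_S(\underline{\mathsf y})]/(SP)$, and let $$\mathsf{mmse}_S=\frac1S\,\mathbf E\big[\|\underline{\mathsf x}-\mathbf E[\underline{\mathsf x}\mid\underline{\mathsf y}]\|^2\big].$$ For a code rate $R$ (nats per channel use), codeword length $N$ (in super symbols) and super symbol length $S$, the encoder uses a codebook of $M=\lceil e^{NSR}\rceil$ independent $\mathcal N(0,PI_{NS})$-distributed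 codewords $\underline x(m)=[\underline x_1(m),\dots,\underline x_N(m)]$, and upon receiving $\underline y=[\underline y_1,\dots,\underline y_N]$ the decoder decides for the message that minimizes $D(m)=\sum_{n=1}^N\|g_S(\underline y_n)-a_S\,\underline x_n(m)\|^2$, ties being counted as errors. Let $P_e(S,N,R)$ be the probability of decoding error, averaged over equiprobable messages and over the codebook ensemble. Assume that $\mathsf{mmse}=\lim_{S\to\infty}\mathsf{mmse}_S$ exists. Then the information rate $$I_{\mathrm{GMI},\mathrm{MMSE}}=\frac12\log\frac{P}{\mathsf{mmse}}$$ ($+\infty$ if $\mathsf{mmse}=0$) is achievable, in the following sense. For every $R<I_{\mathrm{GMI},\mathrm{MMSE}}$: 1. for every $\varepsilon>0$ there is $S_0$ such that for every $S\ge S_0$ one has $P_e(S,N,R)\le\varepsilon$ for all sufficiently large $N$; 2. there is $S_1$ such that for every fixed $S\ge S_1$ for which the process of length-$S$ super symbols is itself ergodic (that is, the $S$-th power of the shift is ergodic), $P_e(S,N,R)\to0$ as $N\to\infty$. -/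

import Mathlib

open MeasureTheory ProbabilityTheory Filter Topology
open scoped NNReal ENNReal

noncomputable section

namespace MemoryChannel

variable {𝒴 : Type*} [MeasurableSpace 𝒴]

/-- The law `𝒩(0, P Iₙ)` of an i.i.d. Gaussian input block of length `n`. -/
def gaussianBlock (P : ℝ≥0) (n : ℕ) : Measure (Fin n → ℝ) :=
  Measure.pi fun _ => gaussianReal 0 P

/-- A channel with memory is given by its transition laws `W n` for all block lengths `n`. This is
the joint law of an i.i.d. Gaussian input block of length `n` and the corresponding output block. -/
def jointLaw (P : ℝ≥0) (W : ∀ n, Kernel (Fin n → ℝ) (Fin n → 𝒴)) (n : ℕ) :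
    Measure ((Fin n → ℝ) × (Fin n → 𝒴)) :=
  (gaussianBlock P n) ⊗ₘ (W n)

/-- The left shift on sequences. -/
def shift {α : Type*} (ω : ℕ → α) : ℕ → α := fun k => ω (k + 1)

/-- The initial segment of length `n` of an input/output sequence, split into inputs and outputs. -/
def segment (n : ℕ) (ω : ℕ → ℝ × 𝒴) : (Fin n → ℝ) × (Fin n → 𝒴) :=
  (fun i => (ω i).1, fun i => (ω i).2)

/-- Under i.i.d. Gaussian inputs, the channel inputs and outputs of a block of any length `n` are
a segment drawn from the stationary and ergodic input/output process with law `μ`. -/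
structure IsStationaryErgodic (P : ℝ≥0) (W : ∀ n, Kernel (Fin n → ℝ) (Fin n → 𝒴))
    (μ : Measure (ℕ → ℝ × 𝒴)) : Prop where
  isProbabilityMeasure : IsProbabilityMeasure μ
  ergodic : Ergodic shift μ
  map_segment : ∀ n, μ.map (segment n) = jointLaw P W n

/-- The `σ`-algebra generated by the output super symbol. -/
abbrev outputSigma (𝒴 : Type*) [MeasurableSpace 𝒴] (S : ℕ) :
    MeasurableSpace ((Fin S → ℝ) × (Fin S → 𝒴)) :=
  MeasurableSpace.comap Prod.snd inferInstance

/-- `E[x | y]`, coordinate by coordinate, for a super symbol of length `S`. -/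
def condMean (P : ℝ≥0) (W : ∀ n, Kernel (Fin n → ℝ) (Fin n → 𝒴)) (S : ℕ) (i : Fin S) :
    (Fin S → ℝ) × (Fin S → 𝒴) → ℝ :=
  (jointLaw P W S)[fun p => p.1 i | outputSigma 𝒴 S]

/-- The normalized MMSE `(1/S) E ‖x - E[x | y]‖²`. -/
def normalizedMMSE (P : ℝ≥0) (W : ∀ n, Kernel (Fin n → ℝ) (Fin n → 𝒴)) (S : ℕ) : ℝ :=
  (1 / (S : ℝ)) * ∫ p, ∑ i : Fin S, (p.1 i - condMean P W S i p) ^ 2 ∂(jointLaw P W S)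

/-- `g` is (a version of) the MMSE smoother `g(y) = E[x | y]`. -/
structure IsMMSESmoother (P : ℝ≥0) (W : ∀ n, Kernel (Fin n → ℝ) (Fin n → 𝒴)) (S : ℕ)
    (g : (Fin S → 𝒴) → (Fin S → ℝ)) : Prop where
  measurable : Measurable g
  ae_eq : ∀ i, (fun p => g p.2 i) =ᵐ[jointLaw P W S] condMean P W S i

/-- An MMSE smoother exists. -/
lemma exists_isMMSESmoother (P : ℝ≥0) (W : ∀ n, Kernel (Fin n → ℝ) (Fin n → 𝒴)) (S : ℕ) :
    ∃ g, IsMMSESmoother P W S g := by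
  have h : ∀ i : Fin S, ∃ f : (Fin S → 𝒴) → ℝ, Measurable f ∧
      condMean P W S i = f ∘ Prod.snd := fun i =>
    (stronglyMeasurable_condExp.measurable
      (f := (jointLaw P W S)[fun p => p.1 i | outputSigma 𝒴 S])).exists_eq_measurable_comp
  choose f hf hfe using h
  refine ⟨fun y i => f i y, measurable_pi_lambda _ hf, fun i => ?_⟩
  rw [hfe i]
  exact Filter.EventuallyEq.rfl

/-- The scaling parameter `a = E[xᵀ g(y)] / (S P)`. -/
def scaling (P : ℝ≥0) (W : ∀ n, Kernel (Fin n → ℝ) (Fin n → 𝒴)) (S : ℕ)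
    (g : (Fin S → 𝒴) → (Fin S → ℝ)) : ℝ :=
  (∫ p, ∑ i : Fin S, p.1 i * g p.2 i ∂(jointLaw P W S)) / (S * P)

/-- The `n`-th length-`S` super symbol of a block of length `N * S`. -/
def superSymbol {α : Type*} {N S : ℕ} (z : Fin (N * S) → α) (n : Fin N) : Fin S → α :=
  fun s => z (finProdFinEquiv (n, s))

/-- The nearest neighbour decoding metric `∑ₙ ‖g(yₙ) - a xₙ‖²` of a codeword `x`. -/
def metric {N S : ℕ} (g : (Fin S → 𝒴) → (Fin S → ℝ)) (a : ℝ)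
    (y : Fin (N * S) → 𝒴) (x : Fin (N * S) → ℝ) : ℝ :=
  ∑ n : Fin N, ∑ s : Fin S, (g (superSymbol y n) s - a * superSymbol x n s) ^ 2

/-- The number `M = ⌈e^{NSR}⌉` of messages for `N` super symbols of length `S` at rate `R` (nats
per channel use). -/
def numMessages (N S : ℕ) (R : ℝ) : ℕ := ⌈Real.exp (N * S * R)⌉₊

/-- The codebook `c` and the output block `y` lead to a decoding error for the message `m`: the
codeword of `m` is not the unique minimizer of the metric. (Ties count as errors.) -/
def IsError {N S M : ℕ} (g : (Fin S → 𝒴) → (Fin S → ℝ)) (a : ℝ)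
    (c : Fin M → Fin (N * S) → ℝ) (m : Fin M) (y : Fin (N * S) → 𝒴) : Prop :=
  ∃ m' : Fin M, m' ≠ m ∧ metric g a y (c m') ≤ metric g a y (c m)

/-- The probability of decoding error, averaged over equiprobable messages and over the ensemble of
codebooks of `M = ⌈e^{NSR}⌉` independent `𝒩(0, P I_{NS})` codewords. -/
def averageError (P : ℝ≥0) (W : ∀ n, Kernel (Fin n → ℝ) (Fin n → 𝒴)) (S : ℕ)
    (g : (Fin S → 𝒴) → (Fin S → ℝ)) (a R : ℝ) (N : ℕ) : ℝ≥0∞ :=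
  ((numMessages N S R : ℕ) : ℝ≥0∞)⁻¹ * ∑ m : Fin (numMessages N S R),
    ∫⁻ c, W (N * S) (c m) {y | IsError g a c m y}
      ∂(Measure.pi fun _ : Fin (numMessages N S R) => gaussianBlock P (N * S))

/-- The rate `I` (possibly `+∞`) is achievable with processing functions `g S` and scaling
parameters `a S`: at every code rate `R < I`, the average probability of decoding error is
eventually below every `ε > 0`, for all large super symbol lengths `S` and all codeword lengths `N`
that are large enough for this `S`. -/
def IsAchievable (P : ℝ≥0) (W : ∀ n, Kernel (Fin n → ℝ) (Fin n → 𝒴))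
    (g : ∀ S, (Fin S → 𝒴) → (Fin S → ℝ)) (a : ℕ → ℝ) (I : EReal) : Prop :=
  ∀ R : ℝ, (R : EReal) < I → ∀ ε : ℝ≥0∞, 0 < ε →
    ∀ᶠ S : ℕ in atTop, ∀ᶠ N : ℕ in atTop, averageError P W S (g S) (a S) R N ≤ ε

/-- The rate `I` is achievable with a fixed super symbol length, which may be any large `S` with
`Q S`: at every code rate `R < I`, the average probability of decoding error with such an `S` tends
to `0` as the codeword length `N` tends to infinity. -/
def IsAchievableFixedLength (P : ℝ≥0) (W : ∀ n, Kernel (Fin n → ℝ) (Fin n → 𝒴))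
    (g : ∀ S, (Fin S → 𝒴) → (Fin S → ℝ)) (a : ℕ → ℝ) (Q : ℕ → Prop) (I : EReal) : Prop :=
  ∀ R : ℝ, (R : EReal) < I → ∀ᶠ S : ℕ in atTop, Q S →
    Tendsto (averageError P W S (g S) (a S) R) atTop (𝓝 0)

/-- The rate `½ log (P / mmse)` in nats, equal to `+∞` if `mmse = 0`. -/
def gmiRate (P : ℝ≥0) (mmse : ℝ) : EReal :=
  (((1 : ℝ) / 2 : ℝ) : EReal) * ENNReal.log ((P : ℝ≥0∞) / ENNReal.ofReal mmse)

end MemoryChannel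

end

namespace MemoryChannel

/-! ### The mean ergodic theorem in L¹. -/

section MeanErgodic

variable {α : Type*} [MeasurableSpace α] {μ : Measure α}

/-! Fix the transmitted codeword and the output. A competing codeword is independent of both, so a
Chernoff bound with parameter t bounds its probability of winning by the exponential of t·D −
t·E/(1+2ta²P) − (NS/2)·log(1+2ta²P). Here D is the metric of the true codeword and E is the energy
of the smoothed output (`gaussianBlock_metric_le`). A union bound over the codebook then reduces the
theorem to the concentration of D and E (`averageError_le`).

By orthogonality, E[xᵀg] = E‖g‖² = SPa per super symbol, hence 1 − a = mmse_S/P, and the means of D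
and E per channel use are aP(1−a) and aP. If t is chosen with 1+2ta²P = 1/(1−a), the first two terms
cancel at these means and the exponent is ½ log(mmse_S/P) per channel use. The proof uses a constant
b < 1 with b ≤ a in place of a, which keeps t finite when the MMSE vanishes and gives margins
independent of S (`exponent_le`, `exists_rate_margin`).

If the S-th power of the shift is ergodic, concentration is the mean ergodic theorem. In general D
is compared with a Birkhoff sum for the shift itself: each estimate in the interior of a super
symbol is replaced by the one from a window of fixed radius m around its position. By Pythagoras the
squared L² error is a difference of estimate powers. Monotonicity in the window and convergence of
`meanPower` make the average difference small (`exists_centreLoss_approx`). -/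

lemma integral_abs_le_norm_toLp_two [IsProbabilityMeasure μ] {f : α → ℝ} (hf : MemLp f 2 μ) :
    ∫ ω, |f ω| ∂μ ≤ ‖hf.toLp f‖ := by
  have h1 : eLpNorm f 1 μ ≤ eLpNorm f 2 μ :=
    eLpNorm_le_eLpNorm_of_exponent_le (by norm_num) hf.1
  rw [Lp.norm_toLp]
  have h2 : ∫ ω, |f ω| ∂μ = (eLpNorm f 1 μ).toReal := by
    rw [eLpNorm_one_eq_lintegral_enorm, ← integral_norm_eq_lintegral_enorm hf.1]
    simp only [Real.norm_eq_abs]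
  rw [h2]
  exact ENNReal.toReal_mono hf.2.ne h1

lemma memLp_birkhoffAverage {T : α → α} (hT : MeasurePreserving T μ μ) {f : α → ℝ} {p : ℝ≥0∞}
    (hf : MemLp f p μ) (N : ℕ) : MemLp (birkhoffAverage ℝ T f N) p μ := by
  have h : birkhoffAverage ℝ T f N = (N : ℝ)⁻¹ • fun ω => ∑ n ∈ Finset.range N, f (T^[n] ω) := by
    ext ω; simp [birkhoffAverage, birkhoffSum]
  rw [h]
  exact (memLp_finsetSum _ fun n _ => hf.comp_measurePreserving (hT.iterate n)).const_smul _

lemma integral_birkhoffSum {T : α → α} (hT : MeasurePreserving T μ μ) {f : α → ℝ}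
    (hf : Integrable f μ) (N : ℕ) : ∫ ω, birkhoffSum T f N ω ∂μ = N * ∫ ω, f ω ∂μ := by
  have hi : ∀ n, Integrable (fun ω => f (T^[n] ω)) μ := fun n =>
    (hT.iterate n).integrable_comp_of_integrable hf
  simp only [birkhoffSum]
  rw [integral_finsetSum _ fun n _ => hi n]
  have h : ∀ n, ∫ ω, f (T^[n] ω) ∂μ = ∫ ω, f ω ∂μ := fun n => by
    have hm := (hT.iterate n).map_eq
    conv_rhs => rw [← hm]
    rw [integral_map (hT.iterate n).measurable.aemeasurable (by rw [hm]; exact hf.1)]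
  simp [h]

/-- The mean ergodic theorem for square integrable functions, in `L¹` form. -/
theorem tendsto_integral_abs_birkhoffAverage_sub [IsProbabilityMeasure μ] {T : α → α}
    (hT : Ergodic T μ) {f : α → ℝ} (hf : MemLp f 2 μ) :
    Tendsto (fun N => ∫ ω, |birkhoffAverage ℝ T f N ω - ∫ ω', f ω' ∂μ| ∂μ) atTop (𝓝 0) := by
  have hmp := hT.toMeasurePreserving
  set U : Lp ℝ 2 μ →L[ℝ] Lp ℝ 2 μ :=
    (Lp.compMeasurePreservingₗᵢ ℝ T hmp).toContinuousLinearMap with hU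
  have hU1 : ‖U‖ ≤ 1 := LinearIsometry.norm_toContinuousLinearMap_le _
  -- Von Neumann's theorem for the Koopman isometry f ↦ f ∘ T: the averages converge in L² to the
  -- projection onto the fixed vectors, which ergodicity forces to be constants.
  have hlim := U.tendsto_birkhoffAverage_orthogonalProjection hU1 (hf.toLp f)
  set F : Lp ℝ 2 μ := ((U.eqLocus (1 : Lp ℝ 2 μ →L[ℝ] Lp ℝ 2 μ)).orthogonalProjectionOnto
    (hf.toLp f) : Lp ℝ 2 μ) with hF
  have hfix : U F = F := by
    have := ((U.eqLocus (1 : Lp ℝ 2 μ →L[ℝ] Lp ℝ 2 μ)).orthogonalProjectionOnto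
      (hf.toLp f)).2
    exact this
  obtain ⟨c, hc⟩ : ∃ c : ℝ, (F : α → ℝ) =ᵐ[μ] Function.const α c := by
    refine hT.ae_eq_const_of_ae_eq_comp_ae (Lp.aestronglyMeasurable F) ?_
    have h := Lp.coeFn_compMeasurePreserving F hmp
    have h2 : Lp.compMeasurePreserving T hmp F = F := hfix
    rw [h2] at h
    exact h.symm
  have hiter : ∀ n, U^[n] (hf.toLp f) = (hf.comp_measurePreserving (hmp.iterate n)).toLp _ := by
    intro n
    induction n with
    | zero => rfl
    | succ n ih =>
      rw [Function.iterate_succ_apply', ih]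
      rfl
  have havg : ∀ N, birkhoffAverage ℝ U _root_.id N (hf.toLp f) =
      (memLp_birkhoffAverage hmp hf N).toLp _ := by
    intro N
    apply Lp.ext
    refine EventuallyEq.trans ?_ (MemLp.coeFn_toLp _).symm
    simp only [birkhoffAverage, birkhoffSum, hiter, _root_.id]
    refine (Lp.coeFn_smul _ _).trans ?_
    have h1 : ∀ᵐ ω ∂μ, ∀ n, ((hf.comp_measurePreserving (hmp.iterate n)).toLp _ : Lp ℝ 2 μ) ω =
        (f ∘ T^[n]) ω := ae_all_iff.2 fun n => MemLp.coeFn_toLp _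
    have h2 := Lp.coeFn_finsetSum (Finset.range N) fun n =>
      ((hf.comp_measurePreserving (hmp.iterate n)).toLp _ : Lp ℝ 2 μ)
    filter_upwards [h1, h2] with ω h1 h2
    simp only [Pi.smul_apply, h2, Finset.sum_apply, h1, Function.comp_apply]
    rfl
  have hcm : MemLp (fun _ : α => c) 2 μ := memLp_const c
  have hFc : F = hcm.toLp _ := Lp.ext (hc.trans hcm.coeFn_toLp.symm)
  have hc0 : Tendsto (fun N => ∫ ω, |birkhoffAverage ℝ T f N ω - c| ∂μ) atTop (𝓝 0) := by
    have h := (tendsto_iff_norm_sub_tendsto_zero.1 hlim)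
    refine squeeze_zero (fun N => integral_nonneg fun _ => abs_nonneg _) (fun N => ?_) h
    change _ ≤ ‖birkhoffAverage ℝ U _root_.id N (hf.toLp f) - F‖
    rw [havg, hFc, ← MemLp.toLp_sub]
    exact integral_abs_le_norm_toLp_two ((memLp_birkhoffAverage hmp hf N).sub hcm)
  -- Each average with N > 0 has mean ∫ f, so the constant limit can only be ∫ f.
  have hcI : c = ∫ ω, f ω ∂μ := by
    have hle : ∀ᶠ N : ℕ in atTop, |∫ ω, f ω ∂μ - c| ≤
        ∫ ω, |birkhoffAverage ℝ T f N ω - c| ∂μ := by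
      filter_upwards [eventually_gt_atTop 0] with N hN
      have hi := (memLp_birkhoffAverage hmp hf N).integrable (by norm_num)
      have h1 : ∫ ω, birkhoffAverage ℝ T f N ω ∂μ = ∫ ω, f ω ∂μ := by
        simp only [birkhoffAverage, smul_eq_mul]
        rw [integral_const_mul, integral_birkhoffSum hmp (hf.integrable (by norm_num))]
        field_simp
      have h2 : ∫ ω, f ω ∂μ - c = ∫ ω, (birkhoffAverage ℝ T f N ω - c) ∂μ := by
        rw [integral_sub hi (integrable_const c), h1]; simp
      rw [h2]
      exact abs_integral_le_integral_abs
    have := ge_of_tendsto hc0 hle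
    have := abs_nonpos_iff.1 this
    linarith
  rw [← hcI]
  exact hc0

end MeanErgodic

/-! ### Laplace transform of a squared distance to a Gaussian. -/

section Gaussian

/-- Completing the square in x. The normalization 1/√v is written as exp(−(log v)/2), so that
products over coordinates become sums in the exponent. -/
lemma gaussianPDFReal_mul_exp_neg_sq {P : ℝ≥0} (hP : 0 < P) {t : ℝ} (ht : 0 ≤ t) (a h x : ℝ) :
    gaussianPDFReal 0 P x * Real.exp (-(t * (h - a * x) ^ 2)) =
      Real.exp (-(t / (1 + 2 * t * a ^ 2 * P) * h ^ 2) - Real.log (1 + 2 * t * a ^ 2 * P) / 2) *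
        gaussianPDFReal (2 * t * a * h * P / (1 + 2 * t * a ^ 2 * P))
          (P / (1 + 2 * t * a ^ 2 * P)).toNNReal x := by
  have hP' : (0 : ℝ) < P := hP
  have hv : (0 : ℝ) < 1 + 2 * t * a ^ 2 * P := by positivity
  have hcast : ((P / (1 + 2 * t * a ^ 2 * P)).toNNReal : ℝ) = P / (1 + 2 * t * a ^ 2 * P) :=
    Real.coe_toNNReal _ (by positivity)
  simp only [gaussianPDFReal, hcast]
  set v := 1 + 2 * t * a ^ 2 * P with hvdef
  have hlog : Real.exp (-(t / v * h ^ 2) - Real.log v / 2) =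
      Real.exp (-(t / v * h ^ 2)) * (√v)⁻¹ := by
    rw [sub_eq_add_neg, Real.exp_add, Real.exp_neg (Real.log v / 2),
      ← Real.log_sqrt hv.le, Real.exp_log (Real.sqrt_pos.2 hv)]
  have hs : √(2 * Real.pi * (P / v)) = √(2 * Real.pi * P) / √v := by
    rw [← mul_div_assoc, Real.sqrt_div' _ hv.le]
  have hsv : √v ≠ 0 := (Real.sqrt_pos.2 hv).ne'
  rw [hlog, hs, inv_div]
  have he : Real.exp (-(x - 0) ^ 2 / (2 * P)) * Real.exp (-(t * (h - a * x) ^ 2)) =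
      Real.exp (-(t / v * h ^ 2)) * Real.exp (-(x - 2 * t * a * h * P / v) ^ 2 / (2 * (P / v))) := by
    rw [← Real.exp_add, ← Real.exp_add]
    congr 1
    field_simp
    rw [hvdef]
    ring
  calc _ = (√(2 * Real.pi * P))⁻¹ *
        (Real.exp (-(x - 0) ^ 2 / (2 * P)) * Real.exp (-(t * (h - a * x) ^ 2))) := by ring
    _ = _ := by rw [he]; field_simp

/-- The Laplace transform of the squared distance between `h` and a scaled Gaussian. -/
lemma lintegral_exp_neg_sq_gaussianReal {P : ℝ≥0} (hP : 0 < P) {t : ℝ} (ht : 0 ≤ t) (a h : ℝ) :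
    ∫⁻ x, ENNReal.ofReal (Real.exp (-(t * (h - a * x) ^ 2))) ∂gaussianReal 0 P =
      ENNReal.ofReal (Real.exp (-(t / (1 + 2 * t * a ^ 2 * P) * h ^ 2) -
        Real.log (1 + 2 * t * a ^ 2 * P) / 2)) := by
  rw [gaussianReal_of_var_ne_zero 0 hP.ne',
    lintegral_withDensity_eq_lintegral_mul _ (measurable_gaussianPDF 0 P) (by fun_prop)]
  simp only [Pi.mul_apply, gaussianPDF]
  have hP' : (0 : ℝ) < P := hP
  have hv : (P / (1 + 2 * t * a ^ 2 * P)).toNNReal ≠ 0 :=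
    (Real.toNNReal_pos.2 (by positivity)).ne'
  calc _ = ∫⁻ x, ENNReal.ofReal (Real.exp (-(t / (1 + 2 * t * a ^ 2 * P) * h ^ 2) -
        Real.log (1 + 2 * t * a ^ 2 * P) / 2)) *
          ENNReal.ofReal (gaussianPDFReal (2 * t * a * h * P / (1 + 2 * t * a ^ 2 * P))
          (P / (1 + 2 * t * a ^ 2 * P)).toNNReal x) := by
        refine lintegral_congr fun x => ?_
        rw [← ENNReal.ofReal_mul (gaussianPDFReal_nonneg _ _ _),
          ← ENNReal.ofReal_mul (Real.exp_nonneg _), gaussianPDFReal_mul_exp_neg_sq hP ht]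
    _ = _ := by
        rw [lintegral_const_mul _ (by fun_prop), lintegral_gaussianPDFReal_eq_one _ hv, mul_one]

end Gaussian

/-! ### Random coding: pairwise Chernoff bound and union bound. -/

section RandomCoding

variable {𝒴 : Type*} [MeasurableSpace 𝒴]

instance (P : ℝ≥0) (n : ℕ) : IsProbabilityMeasure (gaussianBlock P n) := by
  unfold gaussianBlock; infer_instance

instance (P : ℝ≥0) (W : ∀ n, Kernel (Fin n → ℝ) (Fin n → 𝒴)) [∀ n, IsMarkovKernel (W n)] (n : ℕ) :
    IsProbabilityMeasure (jointLaw P W n) := by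
  unfold jointLaw; infer_instance

/-- Chernoff bound for the squared distance between `h` and a scaled Gaussian block. -/
lemma gaussianBlock_sum_sq_le {P : ℝ≥0} (hP : 0 < P) {t : ℝ} (ht : 0 ≤ t) (a : ℝ) {n : ℕ}
    (h : Fin n → ℝ) (d : ℝ) :
    gaussianBlock P n {x | ∑ i, (h i - a * x i) ^ 2 ≤ d} ≤
      ENNReal.ofReal (Real.exp (t * d - t / (1 + 2 * t * a ^ 2 * P) * ∑ i, h i ^ 2 -
        n * (Real.log (1 + 2 * t * a ^ 2 * P) / 2))) := by
  set A : Set (Fin n → ℝ) := {x | ∑ i, (h i - a * x i) ^ 2 ≤ d}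
  have hA : MeasurableSet A := measurableSet_le (by fun_prop) measurable_const
  have hind : iIndepFun (fun (i : Fin n) (x : Fin n → ℝ) =>
      ENNReal.ofReal (Real.exp (-(t * (h i - a * x i) ^ 2)))) (gaussianBlock P n) :=
    iIndepFun_pi (X := fun i x => ENNReal.ofReal (Real.exp (-(t * (h i - a * x) ^ 2))))
      fun i => by fun_prop
  calc gaussianBlock P n A = ∫⁻ x, A.indicator 1 x ∂gaussianBlock P n :=
        (lintegral_indicator_one hA).symm
    _ ≤ ∫⁻ x, ENNReal.ofReal (Real.exp (t * d)) *
          ∏ i, ENNReal.ofReal (Real.exp (-(t * (h i - a * x i) ^ 2))) ∂gaussianBlock P n := by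
        refine lintegral_mono fun x => Set.indicator_apply_le' (fun hx => ?_) fun _ => zero_le
        rw [← ENNReal.ofReal_prod_of_nonneg fun _ _ => Real.exp_nonneg _, ← Real.exp_sum,
          ← ENNReal.ofReal_mul (Real.exp_nonneg _), ← Real.exp_add]
        simp only [Pi.one_apply, ENNReal.one_le_ofReal, Real.one_le_exp_iff, Finset.sum_neg_distrib,
          ← Finset.mul_sum]
        have := mul_le_mul_of_nonneg_left (show _ ≤ d from hx) ht
        linarith
    _ = ENNReal.ofReal (Real.exp (t * d)) * ∏ i, ENNReal.ofReal (Real.exp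
          (-(t / (1 + 2 * t * a ^ 2 * P) * h i ^ 2) - Real.log (1 + 2 * t * a ^ 2 * P) / 2)) := by
        rw [lintegral_const_mul _ (by fun_prop),
          lintegral_prod_eq_prod_lintegral_of_indepFun _ _ hind fun i => by fun_prop]
        congr 1
        refine Finset.prod_congr rfl fun i _ => ?_
        rw [← lintegral_exp_neg_sq_gaussianReal hP ht a (h i)]
        exact (measurePreserving_eval (fun _ : Fin n => gaussianReal 0 P) i).lintegral_comp
          (f := fun x => ENNReal.ofReal (Real.exp (-(t * (h i - a * x) ^ 2)))) (by fun_prop)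
    _ = _ := by
        rw [← ENNReal.ofReal_prod_of_nonneg fun _ _ => Real.exp_nonneg _, ← Real.exp_sum,
          ← ENNReal.ofReal_mul (Real.exp_nonneg _), ← Real.exp_add]
        congr 2
        simp only [Finset.sum_sub_distrib, Finset.sum_neg_distrib, ← Finset.mul_sum,
          Finset.sum_const, Finset.card_univ, Fintype.card_fin, nsmul_eq_mul]
        ring

lemma metric_eq_sum {𝒴 : Type*} {N S : ℕ} (g : (Fin S → 𝒴) → (Fin S → ℝ)) (a : ℝ) (y : Fin (N * S) → 𝒴)
    (x : Fin (N * S) → ℝ) :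
    metric g a y x = ∑ i : Fin (N * S), (g (superSymbol y (finProdFinEquiv.symm i).1)
      (finProdFinEquiv.symm i).2 - a * x i) ^ 2 := by
  rw [← finProdFinEquiv.sum_comp, Fintype.sum_prod_type]
  simp [metric, superSymbol]

/-- The exponent of the pairwise error probability for the Chernoff parameter `t`, given the pair
`p` of the transmitted codeword and the output block. -/
noncomputable def pairwiseExponent (P : ℝ≥0) {N S : ℕ} (g : (Fin S → 𝒴) → (Fin S → ℝ)) (a t : ℝ)
    (p : (Fin (N * S) → ℝ) × (Fin (N * S) → 𝒴)) : ℝ :=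
  t * metric g a p.2 p.1 - t / (1 + 2 * t * a ^ 2 * P) * metric g 0 p.2 p.1 -
    (N * S : ℕ) * (Real.log (1 + 2 * t * a ^ 2 * P) / 2)

lemma gaussianBlock_metric_le {𝒴 : Type*} {P : ℝ≥0} (hP : 0 < P) {t : ℝ} (ht : 0 ≤ t) (a : ℝ) {N S : ℕ}
    (g : (Fin S → 𝒴) → (Fin S → ℝ)) (p : (Fin (N * S) → ℝ) × (Fin (N * S) → 𝒴)) :
    gaussianBlock P (N * S) {x | metric g a p.2 x ≤ metric g a p.2 p.1} ≤
      ENNReal.ofReal (Real.exp (pairwiseExponent P g a t p)) := by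
  have h := gaussianBlock_sum_sq_le hP ht a
    (fun i => g (superSymbol p.2 (finProdFinEquiv.symm i).1) (finProdFinEquiv.symm i).2)
    (metric g a p.2 p.1)
  simp only [← metric_eq_sum] at h
  refine h.trans (le_of_eq ?_)
  -- At scaling 0 the codeword drops out and the metric is the energy of the estimate. The energy
  -- thus inherits measurability and concentration from the metric.
  have h0 : metric g 0 p.2 p.1 = ∑ i : Fin (N * S),
      g (superSymbol p.2 (finProdFinEquiv.symm i).1) (finProdFinEquiv.symm i).2 ^ 2 := by
    rw [metric_eq_sum]; simp
  rw [pairwiseExponent, h0]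

lemma measurable_metric {N S : ℕ} {g : (Fin S → 𝒴) → (Fin S → ℝ)} (hg : Measurable g) (a : ℝ) :
    Measurable fun p : (Fin (N * S) → ℝ) × (Fin (N * S) → 𝒴) => metric g a p.2 p.1 := by
  unfold metric superSymbol
  refine Finset.measurable_sum _ fun n _ => Finset.measurable_sum _ fun s _ => ?_
  have h1 : Measurable fun p : (Fin (N * S) → ℝ) × (Fin (N * S) → 𝒴) =>
      fun s : Fin S => p.2 (finProdFinEquiv (n, s)) :=
    measurable_pi_lambda _ fun s => (measurable_pi_apply _).comp measurable_snd
  have h2 := (measurable_pi_apply s).comp (hg.comp h1)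
  have h3 : Measurable fun p : (Fin (N * S) → ℝ) × (Fin (N * S) → 𝒴) =>
    p.1 (finProdFinEquiv (n, s)) := (measurable_pi_apply _).comp measurable_fst
  exact (h2.sub (h3.const_mul a)).pow_const 2

lemma measurable_pairwiseExponent (P : ℝ≥0) {N S : ℕ} {g : (Fin S → 𝒴) → (Fin S → ℝ)}
    (hg : Measurable g) (a t : ℝ) : Measurable (pairwiseExponent P (N := N) g a t) :=
  (((measurable_metric hg a).const_mul t).sub ((measurable_metric hg 0).const_mul _)).sub_const _

/-- A pairwise error involves only two codewords; this reduces the integral over the whole codebook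
to a double integral. -/
lemma map_eval_pair_pi {ι Ω : Type*} [Fintype ι] [MeasurableSpace Ω] (ν : Measure Ω)
    [IsProbabilityMeasure ν] {i j : ι} (hij : i ≠ j) :
    (Measure.pi fun _ : ι => ν).map (fun c => (c i, c j)) = ν.prod ν := by
  have h : iIndepFun (fun (i : ι) (c : ι → Ω) => c i) (Measure.pi fun _ : ι => ν) :=
    iIndepFun_pi (X := fun _ x => x) fun _ => aemeasurable_id
  have := (indepFun_iff_map_prod_eq_prod_map_map (measurable_pi_apply i).aemeasurable
    (measurable_pi_apply j).aemeasurable).1 (h.indepFun hij)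
  rw [this]
  congr 1 <;> exact (measurePreserving_eval (fun _ : ι => ν) _).map_eq

/-- The probability that one competing codeword beats the transmitted one on a set `A` of pairs of
codewords and outputs where the pairwise error probability is at most `q`. -/
lemma lintegral_pairwise_le {P : ℝ≥0} {n M : ℕ} {κ : Kernel (Fin n → ℝ) (Fin n → 𝒴)}
    [IsMarkovKernel κ] {A : Set ((Fin n → ℝ) × (Fin n → 𝒴))} (hA : MeasurableSet A)
    {f : (Fin n → ℝ) × (Fin n → 𝒴) → ℝ} (hf : Measurable f) {q : ℝ≥0∞}
    (hq : ∀ p ∈ A, gaussianBlock P n {x | f (x, p.2) ≤ f p} ≤ q) {m m' : Fin M} (hm : m' ≠ m) :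
    ∫⁻ c, κ (c m) {y | (c m, y) ∈ A ∧ f (c m', y) ≤ f (c m, y)}
      ∂(Measure.pi fun _ : Fin M => gaussianBlock P n) ≤ q := by
  set B : Set (((Fin n → ℝ) × (Fin n → ℝ)) × (Fin n → 𝒴)) :=
    {z | (z.1.1, z.2) ∈ A ∧ f (z.1.2, z.2) ≤ f (z.1.1, z.2)} with hB
  have hBm : MeasurableSet B :=
    ((by fun_prop : Measurable fun z : ((Fin n → ℝ) × (Fin n → ℝ)) × (Fin n → 𝒴) =>
      (z.1.1, z.2)) hA).inter (measurableSet_le (hf.comp (by fun_prop)) (hf.comp (by fun_prop)))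
  have hF : Measurable fun x : (Fin n → ℝ) × (Fin n → ℝ) => κ x.1 (Prod.mk x ⁻¹' B) :=
    Kernel.measurable_kernel_prodMk_left (κ := κ.comap Prod.fst measurable_fst) hBm
  calc _ = ∫⁻ x, κ x.1 (Prod.mk x ⁻¹' B)
        ∂(Measure.pi fun _ : Fin M => gaussianBlock P n).map (fun c => (c m, c m')) := by
        rw [lintegral_map hF (by fun_prop)]
        rfl
    _ = ∫⁻ x, ∫⁻ x', κ x (Prod.mk (x, x') ⁻¹' B) ∂gaussianBlock P n ∂gaussianBlock P n := by
        rw [map_eval_pair_pi _ hm.symm, lintegral_prod _ hF.aemeasurable]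
    _ ≤ ∫⁻ _, q ∂gaussianBlock P n := by
        refine lintegral_mono fun x => ?_
        have hBx : MeasurableSet {z : (Fin n → ℝ) × (Fin n → 𝒴) | ((x, z.1), z.2) ∈ B} :=
          (by fun_prop : Measurable fun z : (Fin n → ℝ) × (Fin n → 𝒴) => ((x, z.1), z.2)) hBm
        -- The bound q concerns the competing codeword at a fixed output, so the order of
        -- integration over codeword and output is exchanged.
        have h1 := Measure.prod_apply (μ := gaussianBlock P n) (ν := κ x) hBx
        have h2 := Measure.prod_apply_symm (μ := gaussianBlock P n) (ν := κ x) hBx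
        calc _ = ((gaussianBlock P n).prod (κ x)) {z | ((x, z.1), z.2) ∈ B} := h1.symm
          _ = _ := h2
          _ ≤ ∫⁻ _, q ∂(κ x) := by
            refine lintegral_mono fun y => ?_
            by_cases hxy : (x, y) ∈ A
            · refine (measure_mono fun x' hx' => ?_).trans (hq (x, y) hxy)
              exact hx'.2
            · have : ((fun x' => (x', y)) ⁻¹' {z : (Fin n → ℝ) × (Fin n → 𝒴) |
                  ((x, z.1), z.2) ∈ B}) = ∅ := by
                ext x'; simp [hB, hxy]
              rw [this]; simp
          _ = q := by simp
    _ = q := by simp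

/-- The union bound for the error probability of the message `m`, when the message with the least
value of `f` is decided for. -/
lemma lintegral_union_bound {P : ℝ≥0} {n M : ℕ} (κ : Kernel (Fin n → ℝ) (Fin n → 𝒴))
    [IsMarkovKernel κ] {A : Set ((Fin n → ℝ) × (Fin n → 𝒴))} (hAm : MeasurableSet A)
    {f : (Fin n → ℝ) × (Fin n → 𝒴) → ℝ} (hf : Measurable f) {q : ℝ≥0∞}
    (hq : ∀ p ∈ A, gaussianBlock P n {x | f (x, p.2) ≤ f p} ≤ q) (m : Fin M) :
    ∫⁻ c, κ (c m) {y | ∃ m' : Fin M, m' ≠ m ∧ f (c m', y) ≤ f (c m, y)}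
        ∂(Measure.pi fun _ : Fin M => gaussianBlock P n) ≤
      (gaussianBlock P n ⊗ₘ κ) Aᶜ + M * q := by
  have hm1 : Measurable fun x => κ x (Prod.mk x ⁻¹' Aᶜ) :=
    Kernel.measurable_kernel_prodMk_left hAm.compl
  -- Atypical pairs, those outside A, are charged once and not once per competitor.
  calc _ ≤ ∫⁻ c, (κ (c m) (Prod.mk (c m) ⁻¹' Aᶜ) + ∑ m' ∈ Finset.univ.erase m,
          κ (c m) {y | (c m, y) ∈ A ∧ f (c m', y) ≤ f (c m, y)})
          ∂(Measure.pi fun _ : Fin M => gaussianBlock P n) := by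
        refine lintegral_mono fun c => ?_
        calc _ ≤ κ (c m) ((Prod.mk (c m) ⁻¹' Aᶜ) ∪ ⋃ m' ∈ Finset.univ.erase m,
              {y | (c m, y) ∈ A ∧ f (c m', y) ≤ f (c m, y)}) := by
              refine measure_mono fun y hy => ?_
              obtain ⟨m', hne, hle⟩ := hy
              by_cases h : (c m, y) ∈ A
              · right
                simp only [Set.mem_iUnion]
                exact ⟨m', by simp [hne], h, hle⟩
              · left; exact h
          _ ≤ _ := (measure_union_le _ _).trans
              (add_le_add le_rfl (measure_biUnion_finset_le _ _))
    _ = ∫⁻ c, κ (c m) (Prod.mk (c m) ⁻¹' Aᶜ)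
          ∂(Measure.pi fun _ : Fin M => gaussianBlock P n) +
        ∫⁻ c, ∑ m' ∈ Finset.univ.erase m,
          κ (c m) {y | (c m, y) ∈ A ∧ f (c m', y) ≤ f (c m, y)}
          ∂(Measure.pi fun _ : Fin M => gaussianBlock P n) :=
        lintegral_add_left (hm1.comp (measurable_pi_apply m)) _
    _ ≤ _ := by
        refine add_le_add (le_of_eq ?_) ?_
        · rw [Measure.compProd_apply hAm.compl]
          exact (measurePreserving_eval (fun _ : Fin M => gaussianBlock P n) m).lintegral_comp
            hm1
        · have hmeas : ∀ m' : Fin M, Measurable fun c : Fin M → Fin n → ℝ =>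
              κ (c m) {y | (c m, y) ∈ A ∧ f (c m', y) ≤ f (c m, y)} := by
            intro m'
            refine Kernel.measurable_kernel_prodMk_left
              (κ := κ.comap (fun c : Fin M → Fin n → ℝ => c m)
                (measurable_pi_apply m))
              (t := {z | (z.1 m, z.2) ∈ A ∧
                f (z.1 m', z.2) ≤ f (z.1 m, z.2)}) ?_
            have he : ∀ k : Fin M, Measurable fun z : (Fin M → Fin n → ℝ) ×
                (Fin n → 𝒴) => (z.1 k, z.2) := fun k =>
              ((measurable_pi_apply k).comp measurable_fst).prodMk measurable_snd
            exact (he m hAm).inter (measurableSet_le (hf.comp (he m'))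
              (hf.comp (he m)))
          rw [lintegral_finsetSum _ fun m' _ => hmeas m']
          calc _ ≤ ∑ m' ∈ Finset.univ.erase m, q := by
                refine Finset.sum_le_sum fun m' hm' => ?_
                exact lintegral_pairwise_le hAm hf hq (Finset.ne_of_mem_erase hm')
            _ ≤ _ := by
                rw [Finset.sum_const, nsmul_eq_mul]
                gcongr
                exact (Finset.card_le_univ _).trans (by simp)

/-- The random coding bound for the error probability of the message `m`. -/
lemma messageError_le {P : ℝ≥0} (hP : 0 < P) {N S M : ℕ}
    (κ : Kernel (Fin (N * S) → ℝ) (Fin (N * S) → 𝒴)) [IsMarkovKernel κ]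
    {g : (Fin S → 𝒴) → (Fin S → ℝ)} (hg : Measurable g) (a r : ℝ) {t : ℝ} (ht : 0 ≤ t)
    (m : Fin M) :
    ∫⁻ c, κ (c m) {y | IsError g a c m y} ∂(Measure.pi fun _ : Fin M => gaussianBlock P (N * S)) ≤
      (gaussianBlock P (N * S) ⊗ₘ κ) {p | -r < pairwiseExponent P g a t p} +
        M * ENNReal.ofReal (Real.exp (-r)) := by
  set A : Set ((Fin (N * S) → ℝ) × (Fin (N * S) → 𝒴)) :=
    {p | pairwiseExponent P g a t p ≤ -r} with hA
  have hAm : MeasurableSet A := measurableSet_le (measurable_pairwiseExponent P hg a t)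
    measurable_const
  have hAc : {p | -r < pairwiseExponent P g a t p} = Aᶜ := by
    ext p; simp [hA]
  rw [hAc]
  exact lintegral_union_bound κ hAm (measurable_metric hg a) (fun p hp =>
    (gaussianBlock_metric_le hP ht a g p).trans
      (ENNReal.ofReal_le_ofReal (Real.exp_le_exp.2 hp))) m

/-- The random coding bound for nearest neighbour decoding. -/
theorem averageError_le {P : ℝ≥0} (hP : 0 < P) (W : ∀ n, Kernel (Fin n → ℝ) (Fin n → 𝒴))
    [∀ n, IsMarkovKernel (W n)] {N S : ℕ} {g : (Fin S → 𝒴) → (Fin S → ℝ)} (hg : Measurable g)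
    (a R r : ℝ) {t : ℝ} (ht : 0 ≤ t) :
    averageError P W S g a R N ≤
      jointLaw P W (N * S) {p | -r < pairwiseExponent P g a t p} +
        numMessages N S R * ENNReal.ofReal (Real.exp (-r)) := by
  have hM0 : (numMessages N S R : ℝ≥0∞) ≠ 0 := by
    have : 0 < numMessages N S R := Nat.ceil_pos.2 (Real.exp_pos _)
    exact_mod_cast this.ne'
  calc averageError P W S g a R N
      ≤ (numMessages N S R : ℝ≥0∞)⁻¹ * ∑ _m : Fin (numMessages N S R),
        (jointLaw P W (N * S) {p | -r < pairwiseExponent P g a t p} +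
          numMessages N S R * ENNReal.ofReal (Real.exp (-r))) :=
        mul_le_mul_right (Finset.sum_le_sum fun m _ =>
          messageError_le hP (W (N * S)) hg a r ht m) _
    _ = _ := by
        rw [Finset.sum_const, Finset.card_univ, Fintype.card_fin, nsmul_eq_mul, ← mul_assoc,
          ENNReal.inv_mul_cancel hM0 (ENNReal.natCast_ne_top _), one_mul]

/-- With a single message there is no decoding error. -/
lemma averageError_eq_zero_of_nonpos (P : ℝ≥0) (W : ∀ n, Kernel (Fin n → ℝ) (Fin n → 𝒴)) (S : ℕ)
    (g : (Fin S → 𝒴) → (Fin S → ℝ)) (a : ℝ) {R : ℝ} (hR : R ≤ 0) (N : ℕ) :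
    averageError P W S g a R N = 0 := by
  have hM : numMessages N S R ≤ 1 := by
    refine Nat.ceil_le.2 ?_
    rw [Nat.cast_one, Real.exp_le_one_iff]
    exact mul_nonpos_of_nonneg_of_nonpos (by positivity) hR
  have hsub : Subsingleton (Fin (numMessages N S R)) := Fin.subsingleton_iff_le_one.2 hM
  have hE : ∀ (c : Fin (numMessages N S R) → Fin (N * S) → ℝ) m,
      {y | IsError g a c m y} = ∅ := by
    intro c m
    ext y
    simp only [IsError, Set.mem_ofPred_eq, Set.mem_empty_iff_false, iff_false, not_exists, not_and]
    exact fun m' h => absurd (Subsingleton.elim m' m) h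
  simp [averageError, hE]

end RandomCoding

/-! ### Orthogonality of MMSE estimates and monotonicity in the window. -/

section Estimation

variable {𝒴 : Type*} [MeasurableSpace 𝒴]

lemma integral_comp_eq_of_measurePreserving {α β : Type*} [MeasurableSpace α]
    [MeasurableSpace β] {μ : Measure α} {ν : Measure β} {T : α → β} (hT : MeasurePreserving T μ ν)
    {f : β → ℝ} (hf : AEStronglyMeasurable f ν) : ∫ ω, f (T ω) ∂μ = ∫ ω, f ω ∂ν := by
  rw [← hT.map_eq, integral_map hT.measurable.aemeasurable (by rwa [hT.map_eq])]

lemma integral_sub_sq_eq {α : Type*} [MeasurableSpace α] {μ : Measure α} {f h : α → ℝ}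
    (hf : MemLp f 2 μ) (hh : MemLp h 2 μ) :
    ∫ ω, (f ω - h ω) ^ 2 ∂μ = ∫ ω, f ω ^ 2 ∂μ - 2 * ∫ ω, h ω * f ω ∂μ + ∫ ω, h ω ^ 2 ∂μ := by
  have hfh : Integrable (fun ω => 2 * (h ω * f ω)) μ := (hh.integrable_mul hf).const_mul 2
  have hd : Integrable (fun ω => f ω ^ 2 - 2 * (h ω * f ω)) μ := hf.integrable_sq.sub hfh
  have he : ∀ ω, (f ω - h ω) ^ 2 = f ω ^ 2 - 2 * (h ω * f ω) + h ω ^ 2 := fun ω => by ring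
  simp only [he]
  rw [integral_add hd hh.integrable_sq, integral_sub hf.integrable_sq hfh, integral_const_mul]

lemma shift_iterate {α : Type*} (j : ℕ) (ω : ℕ → α) (k : ℕ) : shift^[j] ω k = ω (j + k) := by
  induction j generalizing ω with
  | zero => simp
  | succ j ih => rw [Function.iterate_succ_apply, ih]; simp only [shift]; congr 1; omega

lemma measurable_segment (n : ℕ) : Measurable (segment (𝒴 := 𝒴) n) :=
  Measurable.prodMk (measurable_pi_lambda _ fun _ => measurable_fst.comp (measurable_pi_apply _))
    (measurable_pi_lambda _ fun _ => measurable_snd.comp (measurable_pi_apply _))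

/-- The estimate of the `k`-th input from the first `S` outputs, for `k < S`. -/
noncomputable def estimate {𝒴 : Type*} (g : ∀ S, (Fin S → 𝒴) → (Fin S → ℝ)) (S k : ℕ) (ω : ℕ → ℝ × 𝒴) : ℝ :=
  if h : k < S then g S (segment S ω).2 ⟨k, h⟩ else 0

lemma estimate_of_lt {𝒴 : Type*} (g : ∀ S, (Fin S → 𝒴) → (Fin S → ℝ)) {S k : ℕ} (h : k < S)
    (ω : ℕ → ℝ × 𝒴) : estimate g S k ω = g S (segment S ω).2 ⟨k, h⟩ := dif_pos h

variable {P : ℝ≥0} {W : ∀ n, Kernel (Fin n → ℝ) (Fin n → 𝒴)}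
  {μ : Measure (ℕ → ℝ × 𝒴)} {g : ∀ S, (Fin S → 𝒴) → (Fin S → ℝ)}

lemma measurePreserving_segment (hμ : IsStationaryErgodic P W μ) (n : ℕ) :
    MeasurePreserving (segment n) μ (jointLaw P W n) :=
  ⟨measurable_segment n, hμ.map_segment n⟩

variable [∀ n, IsMarkovKernel (W n)]

lemma measurePreserving_fst_apply (n : ℕ) (i : Fin n) :
    MeasurePreserving (fun p : (Fin n → ℝ) × (Fin n → 𝒴) => p.1 i) (jointLaw P W n)
      (gaussianReal 0 P) :=
  (measurePreserving_eval (fun _ : Fin n => gaussianReal 0 P) i).comp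
    ⟨measurable_fst, Measure.fst_compProd (gaussianBlock P n) (W n)⟩

lemma measurePreserving_input (hμ : IsStationaryErgodic P W μ) (k : ℕ) :
    MeasurePreserving (fun ω : ℕ → ℝ × 𝒴 => (ω k).1) μ (gaussianReal 0 P) :=
  (measurePreserving_fst_apply (k + 1) (Fin.last k)).comp (measurePreserving_segment hμ (k + 1))

lemma memLp_input (hμ : IsStationaryErgodic P W μ) (k : ℕ) {p : ℝ≥0∞} (hp : p ≠ ∞) :
    MemLp (fun ω : ℕ → ℝ × 𝒴 => (ω k).1) p μ :=
  (memLp_id_gaussianReal' p hp).comp_measurePreserving (measurePreserving_input hμ k)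

lemma integral_input_sq (hμ : IsStationaryErgodic P W μ) (k : ℕ) :
    ∫ ω, (ω k).1 ^ 2 ∂μ = P := by
  have hm := measurePreserving_input hμ k
  have h : ∫ x, x ^ 2 ∂gaussianReal 0 P = P := by
    have h1 := variance_eq_sub (memLp_id_gaussianReal' (μ := 0) (v := P) 2 (by norm_num))
    rw [variance_id_gaussianReal] at h1
    have h2 : (gaussianReal 0 P)[id] = 0 := integral_id_gaussianReal
    rw [h2] at h1
    simpa using h1.symm
  rw [← h, ← hm.map_eq, integral_map hm.measurable.aemeasurable (by fun_prop)]

/-- Gaussian inputs have all moments and conditional expectation contracts Lᵖ. The case p = 4 is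
what puts squared errors in L², as the mean ergodic theorem needs. -/
lemma memLp_condMean (S : ℕ) (i : Fin S) {p : ℝ≥0∞} (hp1 : 1 ≤ p) (hp : p ≠ ∞) :
    MemLp (condMean P W S i) p (jointLaw P W S) :=
  MemLp.condExp hp1
    ((memLp_id_gaussianReal' p hp).comp_measurePreserving (measurePreserving_fst_apply S i))

lemma memLp_estimate (hμ : IsStationaryErgodic P W μ) (hg : ∀ S, IsMMSESmoother P W S (g S))
    (S k : ℕ) {p : ℝ≥0∞} (hp1 : 1 ≤ p) (hp : p ≠ ∞) : MemLp (estimate g S k) p μ := by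
  by_cases h : k < S
  · have h1 : MemLp (fun q : (Fin S → ℝ) × (Fin S → 𝒴) => g S q.2 ⟨k, h⟩) p (jointLaw P W S) :=
      (memLp_congr_ae ((hg S).ae_eq ⟨k, h⟩)).2 (memLp_condMean S ⟨k, h⟩ hp1 hp)
    have h2 := h1.comp_measurePreserving (measurePreserving_segment hμ S)
    refine (memLp_congr_ae (Eventually.of_forall fun ω => ?_)).1 h2
    exact (estimate_of_lt g h ω).symm
  · have : estimate g S k = fun _ => 0 := by
      ext ω; simp [estimate, h]
    rw [this]
    exact MemLp.zero'

/-- The orthogonality principle on a super symbol. -/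
lemma integral_fst_mul_eq (hg : ∀ S, IsMMSESmoother P W S (g S)) {S : ℕ} (i : Fin S)
    {φ : (Fin S → 𝒴) → ℝ} (hφ : Measurable φ)
    (hφ2 : MemLp (fun p : (Fin S → ℝ) × (Fin S → 𝒴) => φ p.2) 2 (jointLaw P W S)) :
    ∫ p, φ p.2 * p.1 i ∂jointLaw P W S = ∫ p, φ p.2 * g S p.2 i ∂jointLaw P W S := by
  have hle : outputSigma 𝒴 S ≤ (inferInstance : MeasurableSpace ((Fin S → ℝ) × (Fin S → 𝒴))) :=
    measurable_snd.comap_le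
  have hx : MemLp (fun p : (Fin S → ℝ) × (Fin S → 𝒴) => p.1 i) 2 (jointLaw P W S) :=
    (memLp_id_gaussianReal' 2 (by norm_num)).comp_measurePreserving (measurePreserving_fst_apply S i)
  have hsm : StronglyMeasurable[outputSigma 𝒴 S]
      (fun p : (Fin S → ℝ) × (Fin S → 𝒴) => φ p.2) :=
    (hφ.comp (comap_measurable _)).stronglyMeasurable
  have h := condExp_mul_of_stronglyMeasurable_left hsm (hφ2.integrable_mul hx)
    (hx.integrable (by norm_num))
  calc ∫ p, φ p.2 * p.1 i ∂jointLaw P W S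
      = ∫ p, ((jointLaw P W S)[(fun p => φ p.2) * (fun p => p.1 i) | outputSigma 𝒴 S]) p
          ∂jointLaw P W S := (integral_condExp hle).symm
    _ = ∫ p, φ p.2 * g S p.2 i ∂jointLaw P W S := by
        refine integral_congr_ae ?_
        filter_upwards [h, (hg S).ae_eq i] with p hp hq
        rw [hp, hq]
        rfl

/-- The orthogonality principle on the input/output process. -/
lemma integral_mul_input_eq (hμ : IsStationaryErgodic P W μ)
    (hg : ∀ S, IsMMSESmoother P W S (g S)) {S k : ℕ} (hk : k < S) {φ : (Fin S → 𝒴) → ℝ}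
    (hφ : Measurable φ) (hφ2 : MemLp (fun ω : ℕ → ℝ × 𝒴 => φ (segment S ω).2) 2 μ) :
    ∫ ω, φ (segment S ω).2 * (ω k).1 ∂μ = ∫ ω, φ (segment S ω).2 * estimate g S k ω ∂μ := by
  have hm := measurePreserving_segment hμ S
  have hφ2' : MemLp (fun p : (Fin S → ℝ) × (Fin S → 𝒴) => φ p.2) 2 (jointLaw P W S) := by
    rw [← hm.map_eq]
    exact (memLp_map_measure_iff (hφ.comp measurable_snd).aestronglyMeasurable
      hm.measurable.aemeasurable).2 hφ2
  have h := integral_fst_mul_eq hg ⟨k, hk⟩ hφ hφ2'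
  have hgm : Measurable fun p : (Fin S → ℝ) × (Fin S → 𝒴) => φ p.2 * g S p.2 ⟨k, hk⟩ :=
    (hφ.comp measurable_snd).mul
      ((measurable_pi_apply _).comp ((hg S).measurable.comp measurable_snd))
  have hxm : Measurable fun p : (Fin S → ℝ) × (Fin S → 𝒴) => φ p.2 * p.1 ⟨k, hk⟩ :=
    (hφ.comp measurable_snd).mul ((measurable_pi_apply _).comp measurable_fst)
  rw [← integral_comp_eq_of_measurePreserving hm hgm.aestronglyMeasurable,
    ← integral_comp_eq_of_measurePreserving hm hxm.aestronglyMeasurable] at h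
  simp only [estimate_of_lt g hk]
  exact h

/-- The second moment of the estimate of the `k`-th input from the first `S` outputs. -/
noncomputable def estimatePower (μ : Measure (ℕ → ℝ × 𝒴)) (g : ∀ S, (Fin S → 𝒴) → (Fin S → ℝ))
    (S k : ℕ) : ℝ :=
  ∫ ω, estimate g S k ω ^ 2 ∂μ

lemma integral_estimate_mul_input (hμ : IsStationaryErgodic P W μ)
    (hg : ∀ S, IsMMSESmoother P W S (g S)) {S k : ℕ} (hk : k < S) :
    ∫ ω, estimate g S k ω * (ω k).1 ∂μ = estimatePower μ g S k := by
  have h2 := memLp_estimate hμ hg S k (p := 2) (by norm_num) (by norm_num)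
  have h := integral_mul_input_eq hμ hg hk (φ := fun y => g S y ⟨k, hk⟩)
    ((measurable_pi_apply _).comp (hg S).measurable) (by simpa only [← estimate_of_lt g hk] using h2)
  simp only [← estimate_of_lt g hk] at h
  rw [h, estimatePower]
  simp only [sq]

/-- An estimate from a window that starts at `j` is a function of any longer block of outputs. -/
lemma integral_estimate_mul_estimate_shift (hμ : IsStationaryErgodic P W μ)
    (hg : ∀ S, IsMMSESmoother P W S (g S)) {S L j k : ℕ} (hk : k < L) (hj : j + L ≤ S) :
    ∫ ω, estimate g L k (shift^[j] ω) * estimate g S (j + k) ω ∂μ = estimatePower μ g L k := by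
  have hT := hμ.ergodic.toMeasurePreserving.iterate j
  have h2 := memLp_estimate hμ hg L k (p := 2) (by norm_num) (by norm_num)
  have hx := memLp_input hμ k (p := 2) (by norm_num)
  have he : ∀ ω : ℕ → ℝ × 𝒴, estimate g L k (shift^[j] ω) =
      (fun y : Fin S → 𝒴 => g L (fun i => y ⟨j + i, by omega⟩) ⟨k, hk⟩) (segment S ω).2 := by
    intro ω
    rw [estimate_of_lt g hk]
    simp only [segment, shift_iterate]
  have hφ : Measurable fun y : Fin S → 𝒴 => g L (fun i => y ⟨j + i, by omega⟩) ⟨k, hk⟩ :=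
    (measurable_pi_apply _).comp ((hg L).measurable.comp
      (measurable_pi_lambda _ fun i => measurable_pi_apply _))
  have h := integral_mul_input_eq hμ hg (k := j + k) (by omega) hφ
    (by simp only [← he]; exact h2.comp_measurePreserving hT)
  simp only [← he] at h
  have h3 := integral_comp_eq_of_measurePreserving hT
    (f := fun ω => estimate g L k ω * (ω k).1) (h2.integrable_mul hx).1
  rw [← h, ← integral_estimate_mul_input hμ hg hk, ← h3]
  simp only [shift_iterate]

lemma integrable_estimate_sub_sq (hμ : IsStationaryErgodic P W μ)
    (hg : ∀ S, IsMMSESmoother P W S (g S)) (S k : ℕ) (a : ℝ) :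
    Integrable (fun ω => (estimate g S k ω - a * (ω k).1) ^ 2) μ :=
  ((memLp_estimate hμ hg S k (p := 2) (by norm_num) (by norm_num)).sub
    ((memLp_input hμ k (p := 2) (by norm_num)).const_mul a)).integrable_sq

/-- Orthogonality turns the cross term into −2a times the estimate power. The case a = 1 is the mean
square error, and a = 0 the energy. -/
lemma integral_estimate_sub_sq (hμ : IsStationaryErgodic P W μ)
    (hg : ∀ S, IsMMSESmoother P W S (g S)) {S k : ℕ} (hk : k < S) (a : ℝ) :
    ∫ ω, (estimate g S k ω - a * (ω k).1) ^ 2 ∂μ =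
      (1 - 2 * a) * estimatePower μ g S k + a ^ 2 * P := by
  have he := memLp_estimate hμ hg S k (p := 2) (by norm_num) (by norm_num)
  have hx := memLp_input hμ k (p := 2) (by norm_num)
  have h1 := integral_sub_sq_eq he (hx.const_mul a)
  have h2 : ∀ ω : ℕ → ℝ × 𝒴, a * (ω k).1 * estimate g S k ω = a * (estimate g S k ω * (ω k).1) :=
    fun ω => by ring
  simp only [h2, mul_pow, integral_const_mul] at h1
  rw [h1, integral_estimate_mul_input hμ hg hk, integral_input_sq hμ, estimatePower]
  ring

lemma estimatePower_nonneg (S k : ℕ) : 0 ≤ estimatePower μ g S k :=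
  integral_nonneg fun _ => sq_nonneg _

lemma estimatePower_le (hμ : IsStationaryErgodic P W μ)
    (hg : ∀ S, IsMMSESmoother P W S (g S)) {S k : ℕ} (hk : k < S) :
    estimatePower μ g S k ≤ P := by
  have h := integral_estimate_sub_sq hμ hg hk 1
  have h0 : 0 ≤ ∫ ω, (estimate g S k ω - 1 * (ω k).1) ^ 2 ∂μ := integral_nonneg fun _ => sq_nonneg _
  linarith

/-- Pythagoras: the short-window estimate acts as a projection of the long-window one, so the cross
term is the smaller power. L² closeness is thereby read off from two numbers. -/
lemma integral_estimate_sub_estimate_shift_sq (hμ : IsStationaryErgodic P W μ)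
    (hg : ∀ S, IsMMSESmoother P W S (g S)) {S L j k : ℕ} (hk : k < L) (hj : j + L ≤ S) :
    ∫ ω, (estimate g S (j + k) ω - estimate g L k (shift^[j] ω)) ^ 2 ∂μ =
      estimatePower μ g S (j + k) - estimatePower μ g L k := by
  have hT := hμ.ergodic.toMeasurePreserving.iterate j
  have he := memLp_estimate hμ hg S (j + k) (p := 2) (by norm_num) (by norm_num)
  have hw0 := memLp_estimate hμ hg L k (p := 2) (by norm_num) (by norm_num)
  have hw : MemLp (fun ω => estimate g L k (shift^[j] ω)) 2 μ := hw0.comp_measurePreserving hT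
  have hpow : ∫ ω, estimate g L k (shift^[j] ω) ^ 2 ∂μ = estimatePower μ g L k :=
    integral_comp_eq_of_measurePreserving hT
      (f := fun ω => estimate g L k ω ^ 2) hw0.integrable_sq.1
  rw [integral_sub_sq_eq he hw, integral_estimate_mul_estimate_shift hμ hg hk hj, hpow]
  simp only [estimatePower]
  ring

/-- A longer observation window gives a better estimate. -/
lemma estimatePower_le_of_window (hμ : IsStationaryErgodic P W μ)
    (hg : ∀ S, IsMMSESmoother P W S (g S)) {S L j k : ℕ} (hk : k < L) (hj : j + L ≤ S) :
    estimatePower μ g L k ≤ estimatePower μ g S (j + k) := by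
  have h := integral_estimate_sub_estimate_shift_sq hμ hg hk hj
  have h0 : 0 ≤ ∫ ω, (estimate g S (j + k) ω - estimate g L k (shift^[j] ω)) ^ 2 ∂μ :=
    integral_nonneg fun _ => sq_nonneg _
  linarith

/-- The normalized power of the MMSE estimate of a super symbol of length `S`. -/
noncomputable def meanPower (μ : Measure (ℕ → ℝ × 𝒴)) (g : ∀ S, (Fin S → 𝒴) → (Fin S → ℝ))
    (S : ℕ) : ℝ :=
  (∑ k ∈ Finset.range S, estimatePower μ g S k) / S

lemma meanPower_nonneg (S : ℕ) : 0 ≤ meanPower μ g S :=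
  div_nonneg (Finset.sum_nonneg fun _ _ => estimatePower_nonneg _ _) (Nat.cast_nonneg _)

lemma sum_estimatePower {S : ℕ} (hS : 0 < S) :
    ∑ k ∈ Finset.range S, estimatePower μ g S k = S * meanPower μ g S := by
  have : (S : ℝ) ≠ 0 := by positivity
  rw [meanPower]; field_simp

lemma integral_fst_sub_condMean_sq (hμ : IsStationaryErgodic P W μ)
    (hg : ∀ S, IsMMSESmoother P W S (g S)) {S : ℕ} (i : Fin S) :
    ∫ p, (p.1 i - condMean P W S i p) ^ 2 ∂jointLaw P W S = P - estimatePower μ g S i := by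
  have hm := measurePreserving_segment hμ S
  have h1 : ∫ p, (p.1 i - condMean P W S i p) ^ 2 ∂jointLaw P W S =
      ∫ p, (g S p.2 i - 1 * p.1 i) ^ 2 ∂jointLaw P W S := by
    refine integral_congr_ae ?_
    filter_upwards [(hg S).ae_eq i] with p hp
    rw [← hp]; ring
  have hgm : Measurable fun p : (Fin S → ℝ) × (Fin S → 𝒴) => g S p.2 i :=
    (measurable_pi_apply _).comp ((hg S).measurable.comp measurable_snd)
  have hmeas : Measurable fun p : (Fin S → ℝ) × (Fin S → 𝒴) => (g S p.2 i - 1 * p.1 i) ^ 2 :=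
    (hgm.sub (by fun_prop)).pow_const 2
  have h2 := integral_estimate_sub_sq hμ hg i.2 1
  rw [h1, ← integral_comp_eq_of_measurePreserving hm hmeas.aestronglyMeasurable]
  simp only [estimate_of_lt g i.2, Fin.eta] at h2
  refine Eq.trans h2 ?_
  ring

lemma normalizedMMSE_eq (hμ : IsStationaryErgodic P W μ)
    (hg : ∀ S, IsMMSESmoother P W S (g S)) {S : ℕ} (hS : 0 < S) :
    normalizedMMSE P W S = P - meanPower μ g S := by
  have hS' : (S : ℝ) ≠ 0 := by positivity
  rw [normalizedMMSE, integral_finsetSum]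
  · simp only [integral_fst_sub_condMean_sq hμ hg, Finset.sum_sub_distrib, Finset.sum_const,
      Finset.card_univ, Fintype.card_fin, nsmul_eq_mul]
    rw [← Finset.sum_range fun k => estimatePower μ g S k, sum_estimatePower hS]
    field_simp
  · intro i _
    exact (((memLp_id_gaussianReal' 2 (by norm_num)).comp_measurePreserving
      (measurePreserving_fst_apply S i)).sub
        (memLp_condMean S i (by norm_num) (by norm_num))).integrable_sq

/-- Orthogonality, summed over coordinates. Together with `normalizedMMSE_eq` it gives 1 − a =
mmse_S/P for P > 0, the link between scaling and rate. -/
lemma scaling_eq (hμ : IsStationaryErgodic P W μ)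
    (hg : ∀ S, IsMMSESmoother P W S (g S)) {S : ℕ} (hS : 0 < S) :
    scaling P W S (g S) = meanPower μ g S / P := by
  have hS' : (S : ℝ) ≠ 0 := by positivity
  have hm := measurePreserving_segment hμ S
  have hgm : ∀ i, Measurable fun p : (Fin S → ℝ) × (Fin S → 𝒴) => g S p.2 i := fun i =>
    (measurable_pi_apply _).comp ((hg S).measurable.comp measurable_snd)
  have hmeas : Measurable fun p : (Fin S → ℝ) × (Fin S → 𝒴) => ∑ i, p.1 i * g S p.2 i :=
    Finset.measurable_sum _ fun i _ =>
      (((measurable_pi_apply i).comp measurable_fst).mul (hgm i))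
  have h : ∫ p, ∑ i, p.1 i * g S p.2 i ∂jointLaw P W S = S * meanPower μ g S := by
    rw [← integral_comp_eq_of_measurePreserving hm hmeas.aestronglyMeasurable,
      ← sum_estimatePower hS, Finset.sum_range]
    have he : ∀ (i : Fin S) (ω : ℕ → ℝ × 𝒴), (segment S ω).1 i * g S (segment S ω).2 i =
        estimate g S i ω * (ω i).1 := by
      intro i ω
      rw [estimate_of_lt g i.2, mul_comm]
      rfl
    simp only [he]
    have hi : ∀ i : Fin S, Integrable (fun ω => estimate g S i ω * (ω i).1) μ := fun i =>
      (memLp_estimate hμ hg S i (p := 2) (by norm_num) (by norm_num)).integrable_mul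
        (memLp_input hμ i (p := 2) (by norm_num))
    rw [integral_finsetSum _ fun i _ => hi i]
    exact Finset.sum_congr rfl fun i _ => integral_estimate_mul_input hμ hg i.2
  rw [scaling, h]
  field_simp

end Estimation

/-! ### Concentration of the metric without ergodicity of super symbols. -/

section Concentration

variable {𝒴 : Type*}

/-- The decoding metric of the transmitted super symbol. -/
noncomputable def loss (g : ∀ S, (Fin S → 𝒴) → (Fin S → ℝ)) (a : ℝ) (S : ℕ)
    (ω : ℕ → ℝ × 𝒴) : ℝ :=
  ∑ k ∈ Finset.range S, (estimate g S k ω - a * (ω k).1) ^ 2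

/-- The decoding metric of the transmitted codeword is a Birkhoff sum. -/
lemma metric_segment (g : ∀ S, (Fin S → 𝒴) → (Fin S → ℝ)) (a : ℝ) (S N : ℕ) (ω : ℕ → ℝ × 𝒴) :
    metric (g S) a (segment (N * S) ω).2 (segment (N * S) ω).1 =
      birkhoffSum shift^[S] (loss g a S) N ω := by
  rw [metric, birkhoffSum, Finset.sum_range]
  refine Finset.sum_congr rfl fun n _ => ?_
  rw [loss, Finset.sum_range, ← Function.iterate_mul]
  refine Finset.sum_congr rfl fun s _ => ?_
  rw [estimate_of_lt g s.2, shift_iterate]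
  have h : ∀ s : Fin S, S * (n : ℕ) + s = ((finProdFinEquiv (n, s) : Fin (N * S)) : ℕ) := by
    intro s; simp [finProdFinEquiv]; ring
  simp only [segment, shift_iterate, h, Fin.eta]
  rfl

variable [MeasurableSpace 𝒴] {P : ℝ≥0} {W : ∀ n, Kernel (Fin n → ℝ) (Fin n → 𝒴)}
  [∀ n, IsMarkovKernel (W n)] {μ : Measure (ℕ → ℝ × 𝒴)} {g : ∀ S, (Fin S → 𝒴) → (Fin S → ℝ)}

lemma memLp_sq {α : Type*} [MeasurableSpace α] {μ : Measure α} {f : α → ℝ} (hf : MemLp f 4 μ) :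
    MemLp (fun ω => f ω ^ 2) 2 μ := by
  have : ENNReal.HolderTriple 4 4 2 := ⟨by
    rw [← two_mul, show (4 : ℝ≥0∞) = 2 * 2 by norm_num, ENNReal.mul_inv (by simp) (by simp),
      ← mul_assoc, ENNReal.mul_inv_cancel (by simp) (by simp), one_mul]⟩
  have h := hf.mul (r := 2) hf
  simp only [sq]
  exact h

lemma memLp_estimate_sub_sq (hμ : IsStationaryErgodic P W μ)
    (hg : ∀ S, IsMMSESmoother P W S (g S)) (S k : ℕ) (a : ℝ) :
    MemLp (fun ω => (estimate g S k ω - a * (ω k).1) ^ 2) 2 μ :=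
  memLp_sq ((memLp_estimate hμ hg S k (by norm_num) (by norm_num)).sub
    ((memLp_input hμ k (by norm_num)).const_mul a))

lemma memLp_loss (hμ : IsStationaryErgodic P W μ) (hg : ∀ S, IsMMSESmoother P W S (g S))
    (a : ℝ) (S : ℕ) : MemLp (loss g a S) 2 μ :=
  memLp_finsetSum _ fun k _ => memLp_estimate_sub_sq hμ hg S k a

lemma integral_loss (hμ : IsStationaryErgodic P W μ) (hg : ∀ S, IsMMSESmoother P W S (g S))
    (a : ℝ) {S : ℕ} (hS : 0 < S) :
    ∫ ω, loss g a S ω ∂μ = S * ((1 - 2 * a) * meanPower μ g S + a ^ 2 * P) := by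
  simp only [loss]
  rw [integral_finsetSum _ fun k _ => integrable_estimate_sub_sq hμ hg S k a,
    Finset.sum_congr rfl fun k hk => integral_estimate_sub_sq hμ hg (Finset.mem_range.1 hk) a,
    Finset.sum_add_distrib, ← Finset.mul_sum, sum_estimatePower hS]
  simp
  ring

/-- The integral is affine in the estimate power, which lies in [0, P]; its end values are a²P and
(1−a)²P. This bound pays for the edge terms below. -/
lemma integral_estimate_sub_sq_le (hμ : IsStationaryErgodic P W μ)
    (hg : ∀ S, IsMMSESmoother P W S (g S)) {S k : ℕ} (hk : k < S) {a : ℝ} (ha0 : 0 ≤ a)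
    (ha1 : a ≤ 1) : ∫ ω, (estimate g S k ω - a * (ω k).1) ^ 2 ∂μ ≤ P := by
  rw [integral_estimate_sub_sq hμ hg hk]
  have h0 := estimatePower_nonneg (μ := μ) (g := g) S k
  have h1 := estimatePower_le hμ hg hk
  have hP : (0 : ℝ) ≤ P := P.2
  rcases le_total (2 * a) 1 with h | h
  · nlinarith [mul_nonneg (sub_nonneg.2 h) (sub_nonneg.2 h1), mul_nonneg ha0 hP,
      mul_nonneg (mul_nonneg ha0 (sub_nonneg.2 ha1)) hP]
  · nlinarith [mul_nonneg (sub_nonneg.2 ha1) hP]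

/-- The loss of the estimate of the input in the centre of a window of length `2 * m + 1`. -/
noncomputable def centreLoss (g : ∀ S, (Fin S → 𝒴) → (Fin S → ℝ)) (a : ℝ) (m : ℕ)
    (ω : ℕ → ℝ × 𝒴) : ℝ :=
  (estimate g (2 * m + 1) m ω - a * (ω m).1) ^ 2

/-- Young's inequality with weight η for (x−y)(x+y). It converts L² closeness of errors into L¹
closeness of losses. -/
lemma abs_sq_sub_sq_le {η : ℝ} (hη : 0 < η) (x y : ℝ) :
    |x ^ 2 - y ^ 2| ≤ (x - y) ^ 2 / (2 * η) + η * (x ^ 2 + y ^ 2) := by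
  have h1 : x ^ 2 - y ^ 2 = (x - y) * (x + y) := by ring
  have h2 : (x - y) ^ 2 / (2 * η) + η / 2 * (x + y) ^ 2 ≤
      (x - y) ^ 2 / (2 * η) + η * (x ^ 2 + y ^ 2) := by nlinarith [sq_nonneg (x - y)]
  refine le_trans ?_ h2
  rw [h1, abs_mul, ← sq_abs (x - y), ← sq_abs (x + y)]
  have h3 : |x - y| ^ 2 / (2 * η) + η / 2 * |x + y| ^ 2 - |x - y| * |x + y| =
      (|x - y| - η * |x + y|) ^ 2 / (2 * η) := by field_simp; ring
  have h4 : 0 ≤ (|x - y| - η * |x + y|) ^ 2 / (2 * η) := by positivity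
  linarith

lemma integral_abs_loss_term_sub_le (hμ : IsStationaryErgodic P W μ)
    (hg : ∀ S, IsMMSESmoother P W S (g S)) {a : ℝ} (ha0 : 0 ≤ a) (ha1 : a ≤ 1) {η : ℝ}
    (hη : 0 < η) {S m j : ℕ} (hj : j + (2 * m + 1) ≤ S) :
    ∫ ω, |(estimate g S (j + m) ω - a * (ω (j + m)).1) ^ 2 - centreLoss g a m (shift^[j] ω)| ∂μ ≤
      (estimatePower μ g S (j + m) - estimatePower μ g (2 * m + 1) m) / (2 * η) + η * (2 * P) := by
  have hT := hμ.ergodic.toMeasurePreserving.iterate j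
  have hm : m < 2 * m + 1 := by omega
  have hα := integrable_estimate_sub_sq hμ hg S (j + m) a
  have hβ0 : Integrable (centreLoss g a m) μ := integrable_estimate_sub_sq hμ hg (2 * m + 1) m a
  have hβ : Integrable (fun ω => centreLoss g a m (shift^[j] ω)) μ :=
    hT.integrable_comp_of_integrable hβ0
  have hd : Integrable (fun ω => (estimate g S (j + m) ω -
      estimate g (2 * m + 1) m (shift^[j] ω)) ^ 2) μ :=
    ((memLp_estimate hμ hg S (j + m) (p := 2) (by norm_num) (by norm_num)).sub
      ((memLp_estimate hμ hg (2 * m + 1) m (p := 2) (by norm_num)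
        (by norm_num)).comp_measurePreserving hT)).integrable_sq
  have h1 : Integrable (fun ω => (estimate g S (j + m) ω -
      estimate g (2 * m + 1) m (shift^[j] ω)) ^ 2 / (2 * η)) μ := hd.div_const _
  have h2 : Integrable (fun ω => (estimate g S (j + m) ω - a * (ω (j + m)).1) ^ 2 +
      centreLoss g a m (shift^[j] ω)) μ := hα.add hβ
  calc _ ≤ ∫ ω, ((estimate g S (j + m) ω - estimate g (2 * m + 1) m (shift^[j] ω)) ^ 2 / (2 * η) +
        η * ((estimate g S (j + m) ω - a * (ω (j + m)).1) ^ 2 +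
          centreLoss g a m (shift^[j] ω))) ∂μ := by
        refine integral_mono (hα.sub hβ).abs (h1.add (h2.const_mul η)) fun ω => ?_
        have h := abs_sq_sub_sq_le hη (estimate g S (j + m) ω - a * (ω (j + m)).1)
          (estimate g (2 * m + 1) m (shift^[j] ω) - a * (ω (j + m)).1)
        rw [sub_sub_sub_cancel_right] at h
        simpa only [centreLoss, shift_iterate] using h
    _ = (estimatePower μ g S (j + m) - estimatePower μ g (2 * m + 1) m) / (2 * η) +
        η * (∫ ω, (estimate g S (j + m) ω - a * (ω (j + m)).1) ^ 2 ∂μ +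
          ∫ ω, centreLoss g a m ω ∂μ) := by
        rw [integral_add h1 (h2.const_mul η), integral_const_mul, integral_add hα hβ,
          integral_div, integral_estimate_sub_estimate_shift_sq hμ hg hm hj,
          integral_comp_eq_of_measurePreserving hT hβ0.1]
    _ ≤ _ := by
        have h3 := integral_estimate_sub_sq_le hμ hg (show j + m < S by omega) ha0 ha1
        have h4 : ∫ ω, centreLoss g a m ω ∂μ ≤ P :=
          integral_estimate_sub_sq_le hμ hg hm ha0 ha1
        gcongr
        linarith

/-- The loss on a super symbol is close to a Birkhoff sum of the centre loss. -/
lemma integral_abs_loss_sub_birkhoffSum_le (hμ : IsStationaryErgodic P W μ)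
    (hg : ∀ S, IsMMSESmoother P W S (g S)) {a : ℝ} (ha0 : 0 ≤ a) (ha1 : a ≤ 1) {η : ℝ}
    (hη : 0 < η) {S m : ℕ} (hS : 2 * m < S) :
    ∫ ω, |loss g a S ω - birkhoffSum shift (centreLoss g a m) S ω| ∂μ ≤
      (S * (meanPower μ g S - estimatePower μ g (2 * m + 1) m) + 2 * m * P) / (2 * η) +
        S * (η * (2 * P)) + 4 * m * P := by
  -- L counts window starts, with one spare, so that centred windows of radius m fit inside the
  -- super symbol; m positions remain at each edge.
  obtain ⟨L, hSdef⟩ : ∃ L, S = m + (L + m) := ⟨S - 2 * m, by omega⟩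
  have hsplit : ∀ f : ℕ → ℝ, ∑ k ∈ Finset.range S, f k = ∑ k ∈ Finset.range m, f k +
      (∑ j ∈ Finset.range L, f (j + m) + ∑ k ∈ Finset.range m, f (m + (L + k))) := fun f => by
    rw [hSdef, Finset.sum_range_add, Finset.sum_range_add]
    simp only [add_comm m _]
  have hT := fun j => hμ.ergodic.toMeasurePreserving.iterate j
  set κ := estimatePower μ g (2 * m + 1) m with hκ
  set α : ℕ → (ℕ → ℝ × 𝒴) → ℝ := fun k ω => (estimate g S k ω - a * (ω k).1) ^ 2 with hα
  set β : ℕ → (ℕ → ℝ × 𝒴) → ℝ := fun j ω => centreLoss g a m (shift^[j] ω) with hβ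
  have hα0 : ∀ k ω, 0 ≤ α k ω := fun k ω => sq_nonneg _
  have hβ0 : ∀ k ω, 0 ≤ β k ω := fun k ω => sq_nonneg _
  have hαi : ∀ k, Integrable (α k) μ := fun k => integrable_estimate_sub_sq hμ hg S k a
  have hci : Integrable (centreLoss g a m) μ := integrable_estimate_sub_sq hμ hg (2 * m + 1) m a
  have hβi : ∀ j, Integrable (β j) μ := fun j => (hT j).integrable_comp_of_integrable hci
  have hαP : ∀ k, k < S → ∫ ω, α k ω ∂μ ≤ P := fun k hk =>
    integral_estimate_sub_sq_le hμ hg hk ha0 ha1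
  have hβP : ∀ j, ∫ ω, β j ω ∂μ ≤ P := fun j => by
    rw [hβ, integral_comp_eq_of_measurePreserving (hT j) hci.1]
    exact integral_estimate_sub_sq_le hμ hg (by omega) ha0 ha1
  -- The loss at j + m is matched with the window starting at j. Unmatched are 2m edge losses and
  -- the last 2m windows, each of mean at most P.
  have hpt : ∀ ω, |loss g a S ω - birkhoffSum shift (centreLoss g a m) S ω| ≤
      ∑ j ∈ Finset.range L, |α (j + m) ω - β j ω| + ∑ k ∈ Finset.range m, α k ω +
        ∑ k ∈ Finset.range m, α (m + (L + k)) ω + ∑ k ∈ Finset.range (2 * m), β (L + k) ω := by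
    intro ω
    have h1 : loss g a S ω = ∑ k ∈ Finset.range m, α k ω + (∑ j ∈ Finset.range L, α (j + m) ω +
        ∑ k ∈ Finset.range m, α (m + (L + k)) ω) := hsplit fun k => α k ω
    have h2 : birkhoffSum shift (centreLoss g a m) S ω = ∑ j ∈ Finset.range L, β j ω +
        ∑ k ∈ Finset.range (2 * m), β (L + k) ω := by
      have : birkhoffSum shift (centreLoss g a m) S ω = ∑ k ∈ Finset.range S, β k ω := rfl
      rw [this, show S = L + 2 * m by omega, Finset.sum_range_add]
    have h3 : |∑ j ∈ Finset.range L, α (j + m) ω - ∑ j ∈ Finset.range L, β j ω| ≤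
        ∑ j ∈ Finset.range L, |α (j + m) ω - β j ω| := by
      rw [← Finset.sum_sub_distrib]
      exact Finset.abs_sum_le_sum_abs _ _
    have h4 : 0 ≤ ∑ k ∈ Finset.range m, α k ω := Finset.sum_nonneg fun _ _ => hα0 _ _
    have h5 : 0 ≤ ∑ k ∈ Finset.range m, α (m + (L + k)) ω := Finset.sum_nonneg fun _ _ => hα0 _ _
    have h6 : 0 ≤ ∑ k ∈ Finset.range (2 * m), β (L + k) ω := Finset.sum_nonneg fun _ _ => hβ0 _ _
    rw [h1, h2]
    rw [abs_le] at h3 ⊢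
    constructor <;> linarith [h3.1, h3.2]
  have habs : ∀ j, Integrable (fun ω => |α (j + m) ω - β j ω|) μ := fun j =>
    ((hαi _).sub (hβi j)).abs
  have hi1 : Integrable (fun ω => ∑ j ∈ Finset.range L, |α (j + m) ω - β j ω|) μ :=
    integrable_finsetSum _ fun j _ => habs j
  have hi2 : Integrable (fun ω => ∑ k ∈ Finset.range m, α k ω) μ :=
    integrable_finsetSum _ fun k _ => hαi k
  have hi3 : Integrable (fun ω => ∑ k ∈ Finset.range m, α (m + (L + k)) ω) μ :=
    integrable_finsetSum _ fun k _ => hαi _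
  have hi4 : Integrable (fun ω => ∑ k ∈ Finset.range (2 * m), β (L + k) ω) μ :=
    integrable_finsetSum _ fun k _ => hβi _
  have hi12 : Integrable (fun ω => ∑ j ∈ Finset.range L, |α (j + m) ω - β j ω| +
      ∑ k ∈ Finset.range m, α k ω) μ := hi1.add hi2
  have hi123 : Integrable (fun ω => ∑ j ∈ Finset.range L, |α (j + m) ω - β j ω| +
      ∑ k ∈ Finset.range m, α k ω + ∑ k ∈ Finset.range m, α (m + (L + k)) ω) μ := hi12.add hi3
  have hle := integral_mono_of_nonneg (Eventually.of_forall fun ω => abs_nonneg _)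
    (hi123.add hi4) (Eventually.of_forall hpt)
  simp only [Pi.add_apply] at hle
  rw [integral_add hi123 hi4, integral_add hi12 hi3, integral_add hi1 hi2,
    integral_finsetSum _ fun j _ => habs j,
    integral_finsetSum _ fun k _ => hαi k, integral_finsetSum _ fun k _ => hαi (m + (L + k)),
    integral_finsetSum _ fun k _ => hβi (L + k)] at hle
  have hs2 : ∑ k ∈ Finset.range m, ∫ ω, α k ω ∂μ ≤ m * P := by
    refine (Finset.sum_le_card_nsmul _ _ (P : ℝ) fun k hk => hαP k ?_).trans (by simp)
    have := Finset.mem_range.1 hk; omega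
  have hs3 : ∑ k ∈ Finset.range m, ∫ ω, α (m + (L + k)) ω ∂μ ≤ m * P := by
    refine (Finset.sum_le_card_nsmul _ _ (P : ℝ) fun k hk => hαP _ ?_).trans (by simp)
    have := Finset.mem_range.1 hk; omega
  have hs4 : ∑ k ∈ Finset.range (2 * m), ∫ ω, β (L + k) ω ∂μ ≤ 2 * m * P := by
    refine (Finset.sum_le_card_nsmul _ _ (P : ℝ) fun k _ => hβP _).trans (by simp)
  have hs1 : ∑ j ∈ Finset.range L, ∫ ω, |α (j + m) ω - β j ω| ∂μ ≤
      (∑ j ∈ Finset.range L, estimatePower μ g S (j + m) - L * κ) / (2 * η) +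
        L * (η * (2 * P)) := by
    refine (Finset.sum_le_sum fun j hj => integral_abs_loss_term_sub_le hμ hg ha0 ha1 hη
      (S := S) (m := m) (j := j) ?_).trans (le_of_eq ?_)
    · have := Finset.mem_range.1 hj; omega
    · rw [Finset.sum_add_distrib, ← Finset.sum_div, Finset.sum_sub_distrib]
      simp [hκ]
  have hsum : ∑ j ∈ Finset.range L, estimatePower μ g S (j + m) ≤ S * meanPower μ g S := by
    rw [← sum_estimatePower (show 0 < S by omega)]
    rw [hsplit]
    have h1 : 0 ≤ ∑ k ∈ Finset.range m, estimatePower μ g S k :=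
      Finset.sum_nonneg fun _ _ => estimatePower_nonneg _ _
    have h2 : 0 ≤ ∑ k ∈ Finset.range m, estimatePower μ g S (m + (L + k)) :=
      Finset.sum_nonneg fun _ _ => estimatePower_nonneg _ _
    linarith
  have hκP : κ ≤ P := estimatePower_le hμ hg (by omega)
  have hSL : (S : ℝ) = L + 2 * m := by rw [hSdef]; push_cast; ring
  have hfrac : (∑ j ∈ Finset.range L, estimatePower μ g S (j + m) - L * κ) / (2 * η) ≤
      (S * (meanPower μ g S - κ) + 2 * m * P) / (2 * η) := by
    gcongr
    have : (L : ℝ) * κ = S * κ - 2 * m * κ := by rw [hSL]; ring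
    rw [this]
    have : 2 * (m : ℝ) * κ ≤ 2 * m * P := by gcongr
    linarith
  have hLS : (L : ℝ) * (η * (2 * P)) ≤ S * (η * (2 * P)) := by
    gcongr
    omega
  linarith

/-- For each k < S, a window of length S with k placed at position S fits inside one of length 2S+1,
so the centre power dominates every term of the average. -/
lemma meanPower_le_estimatePower (hμ : IsStationaryErgodic P W μ)
    (hg : ∀ S, IsMMSESmoother P W S (g S)) {S : ℕ} (hS : 0 < S) :
    meanPower μ g S ≤ estimatePower μ g (2 * S + 1) S := by
  have hS' : (0 : ℝ) < S := by positivity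
  rw [meanPower, div_le_iff₀ hS']
  refine (Finset.sum_le_card_nsmul _ _ (estimatePower μ g (2 * S + 1) S) fun k hk => ?_).trans
    (by simp [mul_comm])
  have hk := Finset.mem_range.1 hk
  have h := estimatePower_le_of_window hμ hg (S := 2 * S + 1) (j := S - k) hk (by omega)
  rwa [Nat.sub_add_cancel hk.le] at h

/-- Both the centre power (from below) and `meanPower` at large S (from above) are within ηδ/3 of q.
The gap, Young's weight and the edges cost Sδ/3 each. The radius m is uniform in a, because the
scaling varies with S. -/
lemma exists_centreLoss_approx (hμ : IsStationaryErgodic P W μ)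
    (hg : ∀ S, IsMMSESmoother P W S (g S)) {q : ℝ} (hq : Tendsto (meanPower μ g) atTop (𝓝 q))
    {δ : ℝ} (hδ : 0 < δ) :
    ∃ m, ∀ᶠ S : ℕ in atTop, ∀ a : ℝ, 0 ≤ a → a ≤ 1 →
      ∫ ω, |loss g a S ω - birkhoffSum shift (centreLoss g a m) S ω| ∂μ ≤ S * δ := by
  have hP0 : (0 : ℝ) ≤ P := P.2
  set η : ℝ := δ / (6 * (P + 1)) with hηdef
  have hη : 0 < η := by positivity
  have hηP : η * (2 * P) ≤ δ / 3 := by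
    rw [hηdef, div_mul_eq_mul_div, div_le_div_iff₀ (by positivity) (by positivity)]
    nlinarith
  obtain ⟨m, hm0, hm⟩ := ((eventually_gt_atTop 0).and
    (hq.eventually (lt_mem_nhds (show q - η * δ / 3 < q by
      have : 0 < η * δ := by positivity
      linarith)))).exists
  refine ⟨m, ?_⟩
  have hκ := hm.trans_le (meanPower_le_estimatePower hμ hg hm0)
  have hlin : ∀ᶠ S : ℕ in atTop, 2 * m * P / (2 * η) + 4 * m * P ≤ S * (δ / 3) :=
    (tendsto_natCast_atTop_atTop.atTop_mul_const (by positivity)).eventually_ge_atTop _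
  filter_upwards [hlin, eventually_gt_atTop (2 * m), hq.eventually (gt_mem_nhds
    (show q < q + η * δ / 3 by
      have : 0 < η * δ := by positivity
      linarith))] with S h1 h2 h3 a ha0 ha1
  refine (integral_abs_loss_sub_birkhoffSum_le hμ hg ha0 ha1 hη h2).trans ?_
  have h4 : meanPower μ g S - estimatePower μ g (2 * m + 1) m ≤ 2 * η * (δ / 3) := by linarith
  have h5 : (S * (meanPower μ g S - estimatePower μ g (2 * m + 1) m) + 2 * m * P) / (2 * η) ≤
      S * (δ / 3) + 2 * m * P / (2 * η) := by
    rw [add_div]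
    gcongr
    rw [div_le_iff₀ (by positivity)]
    calc _ ≤ (S : ℝ) * (2 * η * (δ / 3)) := by gcongr
      _ = _ := by ring
  have h6 : (S : ℝ) * (η * (2 * P)) ≤ S * (δ / 3) := by gcongr
  linarith

lemma integral_abs_birkhoffAverage_le {α : Type*} [MeasurableSpace α] {μ : Measure α} {T : α → α}
    (hT : MeasurePreserving T μ μ) {f : α → ℝ} (hf : Integrable f μ) (N : ℕ) :
    ∫ ω, |birkhoffAverage ℝ T f N ω| ∂μ ≤ ∫ ω, |f ω| ∂μ := by
  have h0 : 0 ≤ ∫ ω, |f ω| ∂μ := integral_nonneg fun _ => abs_nonneg _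
  have hi : Integrable (birkhoffSum T (fun ω => |f ω|) N) μ :=
    integrable_finsetSum _ fun n _ => (hT.iterate n).integrable_comp_of_integrable hf.abs
  calc _ ≤ ∫ ω, (N : ℝ)⁻¹ * birkhoffSum T (fun ω => |f ω|) N ω ∂μ := by
        refine integral_mono_of_nonneg (Eventually.of_forall fun _ => abs_nonneg _)
          (hi.const_mul _) (Eventually.of_forall fun ω => ?_)
        simp only [birkhoffAverage, birkhoffSum, smul_eq_mul, abs_mul, abs_inv, Nat.abs_cast]
        gcongr
        exact Finset.abs_sum_le_sum_abs _ _
    _ = (N : ℝ)⁻¹ * (N * ∫ ω, |f ω| ∂μ) := by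
        rw [integral_const_mul, integral_birkhoffSum hT hf.abs]
    _ ≤ _ := by
        rcases Nat.eq_zero_or_pos N with rfl | hN
        · simpa using h0
        · rw [inv_mul_cancel_left₀ (by positivity)]

/-- Consecutive blocks concatenate: this passes from the possibly non-ergodic T^S back to T. -/
lemma birkhoffSum_iterate_birkhoffSum {α : Type*} (T : α → α) (f : α → ℝ) (S N : ℕ) (ω : α) :
    birkhoffSum T^[S] (birkhoffSum T f S) N ω = birkhoffSum T f (N * S) ω := by
  induction N with
  | zero => simp
  | succ N ih =>
    rw [birkhoffSum_succ, ih, Nat.succ_mul, birkhoffSum_add, ← Function.iterate_mul, mul_comm S N]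

/-- The time average of the loss on super symbols is close to its mean, even if the process of
super symbols is not ergodic. -/
theorem eventually_integral_abs_birkhoffAverage_loss_sub_le (hμ : IsStationaryErgodic P W μ)
    (hg : ∀ S, IsMMSESmoother P W S (g S)) {q : ℝ} (hq : Tendsto (meanPower μ g) atTop (𝓝 q))
    {δ : ℝ} (hδ : 0 < δ) :
    ∀ᶠ S : ℕ in atTop, ∀ a : ℝ, 0 ≤ a → a ≤ 1 → ∀ᶠ N : ℕ in atTop,
      ∫ ω, |birkhoffAverage ℝ shift^[S] (loss g a S) N ω - ∫ ω', loss g a S ω' ∂μ| ∂μ ≤ S * δ := by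
  have := hμ.isProbabilityMeasure
  obtain ⟨m, hm⟩ := exists_centreLoss_approx hμ hg hq (show 0 < δ / 3 by positivity)
  filter_upwards [hm, eventually_gt_atTop 0] with S hS hS0 a ha0 ha1
  have hSpos : (0 : ℝ) < S := by positivity
  have hSa := hS a ha0 ha1
  have hT := hμ.ergodic.toMeasurePreserving
  have hTS := hT.iterate S
  have hc2 : MemLp (centreLoss g a m) 2 μ := memLp_estimate_sub_sq hμ hg (2 * m + 1) m a
  have hci := hc2.integrable (by norm_num : (1 : ℝ≥0∞) ≤ 2)
  have hli := (memLp_loss hμ hg a S).integrable (by norm_num : (1 : ℝ≥0∞) ≤ 2)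
  set B := birkhoffSum shift (centreLoss g a m) S with hB
  have hBi : Integrable B μ :=
    integrable_finsetSum _ fun n _ => (hT.iterate n).integrable_comp_of_integrable hci
  set cI := ∫ ω, centreLoss g a m ω ∂μ with hcI
  set lI := ∫ ω, loss g a S ω ∂μ with hlI
  have hlim := (tendsto_integral_abs_birkhoffAverage_sub hμ.ergodic hc2).comp
    (tendsto_id.atTop_mul_const' hS0 : Tendsto (fun N : ℕ => N * S) atTop atTop)
  have hev := hlim.eventually (gt_mem_nhds (show 0 < δ / 3 by positivity))
  filter_upwards [hev, eventually_gt_atTop 0] with N hN hN0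
  have hNpos : (0 : ℝ) < N := by positivity
  have hbias : |S * cI - lI| ≤ S * (δ / 3) := by
    have h1 : lI - S * cI = ∫ ω, (loss g a S ω - B ω) ∂μ := by
      rw [integral_sub hli hBi, hB, integral_birkhoffSum hT hci]
    rw [abs_sub_comm, h1]
    exact abs_integral_le_integral_abs.trans hSa
  have hdi : Integrable (fun ω => loss g a S ω - B ω) μ := hli.sub hBi
  have hav : Integrable (birkhoffAverage ℝ shift^[S] (fun ω => loss g a S ω - B ω) N) μ :=
    memLp_one_iff_integrable.1 (memLp_birkhoffAverage hTS (memLp_one_iff_integrable.2 hdi) N)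
  have hcv : Integrable (fun ω => birkhoffAverage ℝ shift (centreLoss g a m) (N * S) ω - cI) μ :=
    (memLp_one_iff_integrable.1 (memLp_birkhoffAverage hT (memLp_one_iff_integrable.2 hci)
      (N * S))).sub (integrable_const _)
  -- Three errors, each at most Sδ/3 in mean: window approximation, ergodic average of the centre
  -- loss under the shift itself, and the difference of the means.
  have hpt : ∀ ω, |birkhoffAverage ℝ shift^[S] (loss g a S) N ω - lI| ≤
      |birkhoffAverage ℝ shift^[S] (fun ω => loss g a S ω - B ω) N ω| +
        S * |birkhoffAverage ℝ shift (centreLoss g a m) (N * S) ω - cI| + S * (δ / 3) := by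
    intro ω
    have h1 : birkhoffAverage ℝ shift^[S] (fun ω => loss g a S ω - B ω) N ω =
        birkhoffAverage ℝ shift^[S] (loss g a S) N ω -
          S * birkhoffAverage ℝ shift (centreLoss g a m) (N * S) ω := by
      simp only [birkhoffAverage, smul_eq_mul]
      rw [show (fun ω => loss g a S ω - B ω) = loss g a S - B from rfl, birkhoffSum_sub,
        hB, birkhoffSum_iterate_birkhoffSum]
      push_cast
      field_simp
    have h2 : birkhoffAverage ℝ shift^[S] (loss g a S) N ω - lI =
        birkhoffAverage ℝ shift^[S] (fun ω => loss g a S ω - B ω) N ω +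
          S * (birkhoffAverage ℝ shift (centreLoss g a m) (N * S) ω - cI) + (S * cI - lI) := by
      rw [h1]; ring
    rw [h2]
    refine (abs_add_le _ _).trans (add_le_add ((abs_add_le _ _).trans (add_le_add le_rfl ?_)) hbias)
    rw [abs_mul, Nat.abs_cast]
  have hi2 : Integrable (fun ω => S * |birkhoffAverage ℝ shift (centreLoss g a m) (N * S) ω - cI|)
    μ := hcv.abs.const_mul _
  have hi12 : Integrable (fun ω => |birkhoffAverage ℝ shift^[S] (fun ω => loss g a S ω - B ω) N ω| +
        S * |birkhoffAverage ℝ shift (centreLoss g a m) (N * S) ω - cI|) μ := hav.abs.add hi2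
  have hle := integral_mono_of_nonneg (Eventually.of_forall fun ω => abs_nonneg _)
    (hi12.add (integrable_const (S * (δ / 3)))) (Eventually.of_forall hpt)
  simp only [Pi.add_apply] at hle
  rw [integral_add hi12 (integrable_const _), integral_add hav.abs hi2, integral_const_mul] at hle
  simp only [integral_const, probReal_univ, one_smul] at hle
  have h3 := (integral_abs_birkhoffAverage_le hTS hdi N).trans hSa
  have h4 : S * ∫ ω, |birkhoffAverage ℝ shift (centreLoss g a m) (N * S) ω - cI| ∂μ ≤
      S * (δ / 3) := mul_le_mul_of_nonneg_left (le_of_lt hN) hSpos.le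
  linarith

end Concentration

/-! ### Choice of the exponent and achievability. -/

section Achievability

variable {𝒴 : Type*} [MeasurableSpace 𝒴] {P : ℝ≥0} {W : ∀ n, Kernel (Fin n → ℝ) (Fin n → 𝒴)}
  [∀ n, IsMarkovKernel (W n)] {μ : Measure (ℕ → ℝ × 𝒴)} {g : ∀ S, (Fin S → 𝒴) → (Fin S → ℝ)}

/-- The Chernoff parameter for a scaling `a` and a target rate `-log (1 - b) / 2`. -/
noncomputable def chernoffParameter (P : ℝ≥0) (a b : ℝ) : ℝ := b / (2 * a ^ 2 * P * (1 - b))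

lemma one_add_chernoffParameter (hP : 0 < P) {a b : ℝ} (ha : a ≠ 0) (hb1 : b < 1) :
    1 + 2 * chernoffParameter P a b * a ^ 2 * P = (1 - b)⁻¹ := by
  have hP' : (P : ℝ) ≠ 0 := by exact_mod_cast hP.ne'
  have hb : 1 - b ≠ 0 := by linarith
  rw [chernoffParameter]
  field_simp
  ring

/-- The exponent of the pairwise error probability when the metric `d` of the transmitted
codeword and the energy `e` of the estimate are close to their means. -/
lemma exponent_le (hP : 0 < P) {a b γ d e s : ℝ} (hs : 0 ≤ s) (hb0 : 0 < b) (hb1 : b < 1)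
    (hba : b ≤ a) (hγ : 0 ≤ γ)
    (hd : d ≤ s * ((1 - 2 * a) * (a * P) + a ^ 2 * P) + s * (γ * b * P * (1 - b)))
    (he : s * (a * P) - s * (γ * b * P * (1 - b)) ≤ e) :
    chernoffParameter P a b * d - chernoffParameter P a b /
        (1 + 2 * chernoffParameter P a b * a ^ 2 * P) * e -
      s * (Real.log (1 + 2 * chernoffParameter P a b * a ^ 2 * P) / 2) ≤
      s * (Real.log (1 - b) / 2 + γ) := by
  have hP' : (0 : ℝ) < P := hP
  have ha : 0 < a := hb0.trans_le hba
  have hb' : 0 < 1 - b := by linarith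
  rw [one_add_chernoffParameter hP ha.ne' hb1, Real.log_inv]
  set t := chernoffParameter P a b with ht
  have ht0 : 0 ≤ t := by rw [ht, chernoffParameter]; positivity
  -- The tolerance for D and E is scaled so that their two deviations together cost γ(b/a)² ≤ γ.
  have htη : 2 * t * (γ * b * P * (1 - b)) ≤ γ := by
    have h : 2 * t * (γ * b * P * (1 - b)) = γ * (b / a) ^ 2 := by
      rw [ht, chernoffParameter]; field_simp
    rw [h]
    refine mul_le_of_le_one_right hγ (pow_le_one₀ (by positivity) ((div_le_one ha).2 hba))
  have h1 := mul_le_mul_of_nonneg_left hd ht0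
  have htb : t * (1 - b) ≤ t := mul_le_of_le_one_right ht0 (by linarith)
  have h2 := mul_le_mul_of_nonneg_left he (mul_nonneg ht0 hb'.le)
  have h3 : t * (1 - b) * (s * (γ * b * P * (1 - b))) ≤ t * (s * (γ * b * P * (1 - b))) :=
    mul_le_mul_of_nonneg_right htb (by positivity)
  have h4 := mul_le_mul_of_nonneg_left htη hs
  -- At the means, the terms linear in D and E sum to −tsPa(a−b), which is harmless since b ≤ a.
  have h5 : 0 ≤ t * (s * P) * a * (a - b) :=
    mul_nonneg (by positivity) (by linarith)
  rw [div_inv_eq_mul]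
  nlinarith

lemma measure_le_ofReal_integral_div {α : Type*} [MeasurableSpace α] {μ : Measure α}
    [IsFiniteMeasure μ] {f : α → ℝ} (hf : Integrable f μ) {ε : ℝ} (hε : 0 < ε) :
    μ {ω | ε ≤ |f ω|} ≤ ENNReal.ofReal ((∫ ω, |f ω| ∂μ) / ε) := by
  have h := mul_meas_ge_le_integral_of_nonneg (Eventually.of_forall fun ω => abs_nonneg (f ω))
    hf.abs ε
  rw [← ofReal_measureReal]
  exact ENNReal.ofReal_le_ofReal ((le_div_iff₀' hε).2 h)

lemma numMessages_le {N S : ℕ} {R : ℝ} (hR : 0 ≤ R) :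
    (numMessages N S R : ℝ) ≤ 2 * Real.exp (N * S * R) := by
  have h1 : 1 ≤ Real.exp (N * S * R) := Real.one_le_exp (by positivity)
  have h2 := (Nat.ceil_lt_add_one (Real.exp_nonneg (N * S * R))).le
  rw [numMessages]
  linarith

/-- The `L¹` distance between the time average of the loss on `N` super symbols and its mean. -/
noncomputable def lossDeviation (μ : Measure (ℕ → ℝ × 𝒴)) (g : ∀ S, (Fin S → 𝒴) → (Fin S → ℝ))
    (a : ℝ) (S N : ℕ) : ℝ :=
  ∫ ω, |birkhoffAverage ℝ shift^[S] (loss g a S) N ω - ∫ ω', loss g a S ω' ∂μ| ∂μ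

/-- The decoding error probability in terms of the deviation of the empirical means. -/
lemma averageError_le_lossDeviation (hP : 0 < P) (hμ : IsStationaryErgodic P W μ)
    (hg : ∀ S, IsMMSESmoother P W S (g S)) {S N : ℕ} (hS : 0 < S) (hN : 0 < N) {b γ R : ℝ}
    (hb0 : 0 < b) (hb1 : b < 1) (hba : b ≤ scaling P W S (g S)) (hγ : 0 < γ) (hR : 0 ≤ R)
    (hRb : Real.log (1 - b) / 2 ≤ -(R + 2 * γ)) :
    averageError P W S (g S) (scaling P W S (g S)) R N ≤
      ENNReal.ofReal ((lossDeviation μ g (scaling P W S (g S)) S N + lossDeviation μ g 0 S N) /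
        (S * (γ * b * P * (1 - b))) + 2 * Real.exp (-(N * S * γ))) := by
  have := hμ.isProbabilityMeasure
  have hP' : (0 : ℝ) < P := hP
  have hS' : (0 : ℝ) < S := by positivity
  have hN' : (0 : ℝ) < N := by positivity
  have hb' : 0 < 1 - b := by linarith
  set a := scaling P W S (g S) with ha
  have ha0 : 0 < a := hb0.trans_le hba
  have hq : meanPower μ g S = a * P := by
    rw [ha, scaling_eq hμ hg hS]; field_simp
  set t := chernoffParameter P a b with ht
  have ht0 : 0 ≤ t := by rw [ht, chernoffParameter]; positivity
  set η := γ * b * P * (1 - b) with hη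
  have hη0 : 0 < η := by positivity
  -- Of the margin 2γ, one half absorbs the deviations of D and E, the other beats the number of
  -- messages.
  set r := N * S * (R + γ) with hr
  have hi : ∀ a', Integrable (fun ω => birkhoffAverage ℝ shift^[S] (loss g a' S) N ω -
      ∫ ω', loss g a' S ω' ∂μ) μ := fun a' =>
    ((memLp_birkhoffAverage (hμ.ergodic.toMeasurePreserving.iterate S) (memLp_loss hμ hg a' S)
      N).integrable (by norm_num)).sub (integrable_const _)
  have hevent : jointLaw P W (N * S) {p | -r < pairwiseExponent P (g S) a t p} ≤
      ENNReal.ofReal (lossDeviation μ g a S N / (S * η)) +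
        ENNReal.ofReal (lossDeviation μ g 0 S N / (S * η)) := by
    have hm := measurePreserving_segment hμ (N * S)
    rw [← hm.measure_preimage (measurableSet_lt measurable_const
      (measurable_pairwiseExponent P (hg S).measurable a t)).nullMeasurableSet]
    refine (measure_mono (t := {ω | S * η ≤ |birkhoffAverage ℝ shift^[S] (loss g a S) N ω -
      ∫ ω', loss g a S ω' ∂μ|} ∪ {ω | S * η ≤ |birkhoffAverage ℝ shift^[S] (loss g 0 S) N ω -
      ∫ ω', loss g 0 S ω' ∂μ|}) fun ω hω => ?_).trans ((measure_union_le _ _).trans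
        (add_le_add (measure_le_ofReal_integral_div (hi a) (by positivity))
          (measure_le_ofReal_integral_div (hi 0) (by positivity))))
    by_contra hcon
    simp only [Set.mem_union, Set.mem_ofPred_eq, not_or, not_le] at hcon
    obtain ⟨h1, h2⟩ := hcon
    rw [integral_loss hμ hg _ hS, hq] at h1 h2
    have hsum : ∀ a', metric (g S) a' (segment (N * S) ω).2 (segment (N * S) ω).1 =
        N * birkhoffAverage ℝ shift^[S] (loss g a' S) N ω := by
      intro a'
      rw [metric_segment, birkhoffAverage, smul_eq_mul]
      field_simp
    have h3 := exponent_le hP (s := N * S) (by positivity) hb0 hb1 hba hγ.le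
      (d := N * birkhoffAverage ℝ shift^[S] (loss g a S) N ω)
      (e := N * birkhoffAverage ℝ shift^[S] (loss g 0 S) N ω)
      (by nlinarith [(abs_lt.1 h1).2]) (by nlinarith [(abs_lt.1 h2).1])
    have h4 : -r < pairwiseExponent P (g S) a t (segment (N * S) ω) := hω
    rw [pairwiseExponent, hsum, hsum] at h4
    push_cast at h4
    have h5 : (N * S : ℝ) * (Real.log (1 - b) / 2 + γ) ≤ -r := by
      rw [hr, ← mul_neg]
      gcongr
      linarith
    linarith
  have hlD : ∀ a', 0 ≤ lossDeviation μ g a' S N := fun a' => integral_nonneg fun _ => abs_nonneg _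
  refine (averageError_le hP W (hg S).measurable a R r ht0).trans ?_
  rw [add_div, ENNReal.ofReal_add (add_nonneg (div_nonneg (hlD a) (by positivity))
      (div_nonneg (hlD 0) (by positivity))) (by positivity),
    ENNReal.ofReal_add (div_nonneg (hlD a) (by positivity)) (div_nonneg (hlD 0) (by positivity))]
  refine add_le_add hevent ?_
  rw [← ENNReal.ofReal_natCast, ← ENNReal.ofReal_mul (Nat.cast_nonneg _)]
  refine ENNReal.ofReal_le_ofReal ?_
  calc (numMessages N S R : ℝ) * Real.exp (-r)
      ≤ 2 * Real.exp (N * S * R) * Real.exp (-r) := by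
        gcongr
        exact numMessages_le hR
    _ = 2 * Real.exp (-(N * S * γ)) := by
        rw [mul_assoc, ← Real.exp_add, hr]
        congr 2
        ring

/-- The multiplicative form covers mmse = 0 as well: its negation forces mmse > 0, so the logarithm
is finite where it is used. -/
lemma lt_of_lt_gmiRate (hP : 0 < P) {R mmse : ℝ} (h : (R : EReal) < gmiRate P mmse) :
    mmse < P * Real.exp (-(2 * R)) := by
  have hP' : (0 : ℝ) < P := hP
  by_contra! hle
  have hm : 0 < mmse := lt_of_lt_of_le (by positivity) hle
  have hlog : ENNReal.log ((P : ℝ≥0∞) / ENNReal.ofReal mmse) = ((Real.log (P / mmse) : ℝ) : EReal) := by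
    rw [← ENNReal.ofReal_coe_nnreal, ← ENNReal.ofReal_div_of_pos hm, ENNReal.log_ofReal,
      if_neg (not_le.2 (by positivity))]
  rw [gmiRate, hlog, ← EReal.coe_mul, EReal.coe_lt_coe_iff] at h
  have h1 : Real.log (P / mmse) ≤ 2 * R := by
    rw [Real.log_le_iff_le_exp (by positivity), div_le_iff₀ hm]
    calc (P : ℝ) = P * Real.exp (-(2 * R)) * Real.exp (2 * R) := by
          rw [mul_assoc, ← Real.exp_add]; simp
      _ ≤ mmse * Real.exp (2 * R) := by gcongr
      _ = _ := mul_comm _ _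
  linarith

lemma normalizedMMSE_nonneg (P : ℝ≥0) (W : ∀ n, Kernel (Fin n → ℝ) (Fin n → 𝒴)) (S : ℕ) :
    0 ≤ normalizedMMSE P W S :=
  mul_nonneg (by positivity) (integral_nonneg fun _ => Finset.sum_nonneg fun _ _ => sq_nonneg _)

lemma tendsto_meanPower (hμ : IsStationaryErgodic P W μ)
    (hg : ∀ S, IsMMSESmoother P W S (g S)) {mmse : ℝ}
    (hmmse : Tendsto (normalizedMMSE P W) atTop (𝓝 mmse)) :
    Tendsto (meanPower μ g) atTop (𝓝 (P - mmse)) := by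
  refine (tendsto_const_nhds.sub hmmse).congr' ?_
  filter_upwards [eventually_gt_atTop 0] with S hS
  rw [normalizedMMSE_eq hμ hg hS]
  ring

lemma scaling_mem_Icc (hP : 0 < P) (hμ : IsStationaryErgodic P W μ)
    (hg : ∀ S, IsMMSESmoother P W S (g S)) {S : ℕ} (hS : 0 < S) :
    scaling P W S (g S) ∈ Set.Icc 0 1 := by
  have hP' : (0 : ℝ) < P := hP
  have h := normalizedMMSE_nonneg P W S
  rw [normalizedMMSE_eq hμ hg hS] at h
  rw [scaling_eq hμ hg hS]
  exact ⟨div_nonneg (meanPower_nonneg S) hP'.le, (div_le_one hP').2 (by linarith)⟩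

/-- Below the GMI there is a margin that does not depend on the super symbol length. -/
lemma exists_rate_margin (hP : 0 < P) (hμ : IsStationaryErgodic P W μ)
    (hg : ∀ S, IsMMSESmoother P W S (g S)) {mmse : ℝ}
    (hmmse : Tendsto (normalizedMMSE P W) atTop (𝓝 mmse)) {R : ℝ} (hR : 0 < R)
    (hRI : (R : EReal) < gmiRate P mmse) :
    ∃ b γ : ℝ, 0 < b ∧ b < 1 ∧ 0 < γ ∧ Real.log (1 - b) / 2 ≤ -(R + 2 * γ) ∧
      ∀ᶠ S : ℕ in atTop, b ≤ scaling P W S (g S) := by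
  have hP' : (0 : ℝ) < P := hP
  have h0 : 0 ≤ mmse := ge_of_tendsto' hmmse fun S => normalizedMMSE_nonneg P W S
  have h1 := lt_of_lt_gmiRate hP hRI
  -- The number v stays positive even if mmse = 0, whence b = 1 − v/P < 1. The choice of γ makes
  -- log(1−b)/2 = −(R+2γ) an equality.
  obtain ⟨v, hv1, hv2⟩ := exists_between h1
  have hv0 : 0 < v := h0.trans_lt hv1
  have hvP : v / P < Real.exp (-(2 * R)) := by
    rw [div_lt_iff₀ hP']; linarith
  have hvP0 : 0 < v / P := by positivity
  have hexp : Real.exp (-(2 * R)) < 1 := Real.exp_lt_one_iff.2 (by linarith)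
  have hlog : Real.log (v / P) < -(2 * R) := (Real.log_lt_iff_lt_exp hvP0).2 hvP
  refine ⟨1 - v / P, (-(2 * R) - Real.log (v / P)) / 4, by linarith, by linarith, by linarith,
    ?_, ?_⟩
  · rw [sub_sub_cancel]; linarith
  · filter_upwards [eventually_gt_atTop 0, (tendsto_meanPower hμ hg hmmse).eventually
      (lt_mem_nhds (show P - v < P - mmse by linarith))] with S hS hS2
    rw [scaling_eq hμ hg hS, le_div_iff₀ hP', sub_mul, div_mul_cancel₀ _ hP'.ne']
    linarith

lemma tendsto_exp_neg_mul {S : ℕ} (hS : 0 < S) {γ : ℝ} (hγ : 0 < γ) :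
    Tendsto (fun N : ℕ => 2 * Real.exp (-(N * S * γ))) atTop (𝓝 0) := by
  have hS' : (0 : ℝ) < S := by positivity
  have h : Tendsto (fun N : ℕ => (N : ℝ) * S * γ) atTop atTop :=
    (tendsto_natCast_atTop_atTop.atTop_mul_const hS').atTop_mul_const hγ
  simpa using (Real.tendsto_exp_neg_atTop_nhds_zero.comp h).const_mul 2

/-- The GMI is achievable, without ergodicity of the process of super symbols. -/
theorem isAchievable_gmiRate (hP : 0 < P) (hμ : IsStationaryErgodic P W μ)
    (hg : ∀ S, IsMMSESmoother P W S (g S)) {mmse : ℝ}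
    (hmmse : Tendsto (normalizedMMSE P W) atTop (𝓝 mmse)) :
    IsAchievable P W g (fun S => scaling P W S (g S)) (gmiRate P mmse) := by
  intro R hRI ε hε
  rcases le_or_gt R 0 with hR | hR
  · exact Eventually.of_forall fun S => Eventually.of_forall fun N => by
      simp [averageError_eq_zero_of_nonpos P W S (g S) _ hR N]
  obtain ⟨b, γ, hb0, hb1, hγ, hRb, hbS⟩ := exists_rate_margin hP hμ hg hmmse hR hRI
  obtain ⟨ε', hε'0, hε'⟩ : ∃ ε' : ℝ, 0 < ε' ∧ ENNReal.ofReal ε' ≤ ε := by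
    obtain ⟨x, hx0, hx⟩ := ENNReal.lt_iff_exists_nnreal_btwn.1 hε
    exact ⟨x, by exact_mod_cast hx0, by simpa using hx.le⟩
  have hP' : (0 : ℝ) < P := hP
  have hb' : 0 < 1 - b := by linarith
  set η := γ * b * P * (1 - b) with hη
  have hη0 : 0 < η := by positivity
  -- The deviations at scalings a and 0 add up to at most Sηε'/2, which Markov's inequality at level
  -- Sη turns into ε'/2.
  filter_upwards [hbS, eventually_gt_atTop 0, eventually_integral_abs_birkhoffAverage_loss_sub_le
    hμ hg (tendsto_meanPower hμ hg hmmse) (show 0 < η * ε' / 4 by positivity)] with S hS hS0 hdev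
  have hS' : (0 : ℝ) < S := by positivity
  have ha := scaling_mem_Icc hP hμ hg hS0
  filter_upwards [eventually_gt_atTop 0, hdev _ ha.1 ha.2, hdev 0 le_rfl zero_le_one,
    (tendsto_exp_neg_mul hS0 hγ).eventually (gt_mem_nhds (show 0 < ε' / 2 by positivity))]
    with N hN h1 h2 h3
  refine (averageError_le_lossDeviation hP hμ hg hS0 hN hb0 hb1 hS hγ hR.le hRb).trans
    ((ENNReal.ofReal_le_ofReal ?_).trans hε')
  have h4 : (lossDeviation μ g (scaling P W S (g S)) S N + lossDeviation μ g 0 S N) / (S * η) ≤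
      ε' / 2 := by
    rw [div_le_iff₀ (by positivity)]
    calc _ ≤ S * (η * ε' / 4) + S * (η * ε' / 4) := add_le_add h1 h2
      _ = _ := by ring
  linarith

/-- The GMI is achievable with a fixed super symbol length for which the process of super symbols
is ergodic. -/
theorem isAchievableFixedLength_gmiRate (hP : 0 < P) (hμ : IsStationaryErgodic P W μ)
    (hg : ∀ S, IsMMSESmoother P W S (g S)) {mmse : ℝ}
    (hmmse : Tendsto (normalizedMMSE P W) atTop (𝓝 mmse)) :
    IsAchievableFixedLength P W g (fun S => scaling P W S (g S))
      (fun S => Ergodic shift^[S] μ) (gmiRate P mmse) := by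
  have := hμ.isProbabilityMeasure
  intro R hRI
  rcases le_or_gt R 0 with hR | hR
  · refine Eventually.of_forall fun S _ => ?_
    have : averageError P W S (g S) (scaling P W S (g S)) R = fun _ => 0 :=
      funext fun N => averageError_eq_zero_of_nonpos P W S (g S) _ hR N
    simp only [this]
    exact tendsto_const_nhds
  obtain ⟨b, γ, hb0, hb1, hγ, hRb, hbS⟩ := exists_rate_margin hP hμ hg hmmse hR hRI
  filter_upwards [hbS, eventually_gt_atTop 0] with S hS hS0 hE
  -- With the S-th power ergodic, the mean ergodic theorem applies to the loss directly and no
  -- window is needed.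
  have hdev : ∀ a, Tendsto (lossDeviation μ g a S) atTop (𝓝 0) := fun a =>
    tendsto_integral_abs_birkhoffAverage_sub hE (memLp_loss hμ hg a S)
  have hlim : Tendsto (fun N => ENNReal.ofReal
      ((lossDeviation μ g (scaling P W S (g S)) S N + lossDeviation μ g 0 S N) /
        (S * (γ * b * P * (1 - b))) + 2 * Real.exp (-(N * S * γ)))) atTop (𝓝 0) := by
    have h := ENNReal.tendsto_ofReal ((((hdev (scaling P W S (g S))).add (hdev 0)).div_const
      (S * (γ * b * P * (1 - b)))).add (tendsto_exp_neg_mul hS0 hγ))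
    simpa using h
  refine tendsto_of_tendsto_of_tendsto_of_le_of_le' tendsto_const_nhds hlim
    (Eventually.of_forall fun _ => zero_le) ?_
  filter_upwards [eventually_gt_atTop 0] with N hN
  exact averageError_le_lossDeviation hP hμ hg hS0 hN hb0 hb1 hS hγ hR.le hRb

end Achievability

end MemoryChannel

theorem mainTheorem6 {𝒴 : Type*} [MeasurableSpace 𝒴] (P : ℝ≥0) (hP : 0 < P)
    (W : ∀ n, Kernel (Fin n → ℝ) (Fin n → 𝒴)) [∀ n, IsMarkovKernel (W n)]
    (μ : Measure (ℕ → ℝ × 𝒴)) (hμ : MemoryChannel.IsStationaryErgodic P W μ)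
    (g : ∀ S, (Fin S → 𝒴) → (Fin S → ℝ))
    (hg : ∀ S, MemoryChannel.IsMMSESmoother P W S (g S))
    (mmse : ℝ) (hmmse : Tendsto (MemoryChannel.normalizedMMSE P W) atTop (𝓝 mmse)) :
    MemoryChannel.IsAchievable P W g (fun S => MemoryChannel.scaling P W S (g S))
        (MemoryChannel.gmiRate P mmse) ∧
      MemoryChannel.IsAchievableFixedLength P W g (fun S => MemoryChannel.scaling P W S (g S))
        (fun S => Ergodic (MemoryChannel.shift^[S]) μ) (MemoryChannel.gmiRate P mmse) := by
  exact ⟨MemoryChannel.isAchievable_gmiRate hP hμ hg hmmse,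
    MemoryChannel.isAchievableFixedLength_gmiRate hP hμ hg hmmse⟩
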